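/- Let $A\neq 0$ be a basic Artin algebra (a module-finite algebra over a commutative Artinian ring, with a complete set $e_1,\dots,e_n$ of primitive orthogonal idempotents such that the left modules $P(i)=Ae_i$ are pairwise non-isomorphic), with the ordering $1<\dots<n$ of the indices. All modules are left modules; $A\text{-mod}$ is the category of finitely generated ones. Let $E(i)$ be the simple top of $P(i)$. The standard module $\Delta(i)$ is the largest factor module of $P(i)$ without composition factors $E(j)$, $j>i$. The costandard module $\nabla(i)$ is the largest submodule of the injective envelope of $E(i)$ without composition factors $E(j)$, $j>i$, and the proper costandard module $\overline\nabla(i)$ is the largest submodule of $\nabla(i)$ in which $E(i)$ has composition multiplicity $1$. Let $\mathcal F(\Delta)$ and $\mathcal F(\overline\nabla)$ be the classes of finitely generated modules that have a finite filtration whose factors are all isomorphic to modules $\Delta(i)$, respectively $\overline\nabla(i)$. Suppose that $A$ is standardly stratified, that is, ${}_AA\in\mathcal F(\Delta)$. Let $T$ be a characteristic module of $A$, that is, an $A$-module for which $\mathrm{add}\,T=\mathcal F(\Delta)\cap\mathcal F(\overline\nabla)$, where $\mathrm{add}\,T$ is the class of direct summands of finite direct sums of copies of $T$ ($T$ is not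 required to be basic). For $X\in A\text{-mod}$ let $\overline\nabla\text{-gfd}(X)$ be the smallest $s\ge 0$ for which there is an exact sequence $0\to X\to M_0\to\dots\to M_s\to 0$ with all $M_i\in\mathcal F(\overline\nabla)$, and let $T\text{-codim}(X)$ be the smallest $s\ge 0$ for which there is such a sequence with all $M_i\in\mathrm{add}\,T$ (in each case $\infty$ if there is none). Put $\overline\nabla\text{-gfd}(A)=\sup\{\overline\nabla\text{-gfd}(X) : X\in A\text{-mod}\}$. Then for every integer $d\ge 0$ the following are equivalent: 1. $\overline\nabla\text{-gfd}(A)=d$; 2. $\mathrm{proj.dim}_A(T)=d$; 3. $\overline\nabla\text{-gfd}({}_AA)=d$; 4. $T\text{-codim}({}_AA)=d$. -/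

import Mathlib

open CategoryTheory

universe u v

namespace StdStrat

section Modules

variable {A : Type u} [Ring A]

/-- `S` is a composition factor of `M`: some subquotient `N₂ / N₁` with `N₁ ≤ N₂ ≤ M` is isomorphic
to `S`. (Used for simple `S`, and `M` of finite length.) -/
def IsCompositionFactor (S : Type u) [AddCommGroup S] [Module A S]
    (M : Type u) [AddCommGroup M] [Module A M] : Prop :=
  ∃ N₁ N₂ : Submodule A M, N₁ ≤ N₂ ∧ Nonempty ((↥N₂ ⧸ N₁.submoduleOf N₂) ≃ₗ[A] S)

/-- `[M : S] = k`: there is a composition series `0 = s₀ < s₁ < ⋯ < s_ℓ = M` in which exactly `k`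
of the factors `s_{i+1} / s_i` are isomorphic to `S`. By the Jordan-Hölder theorem, `k` does not
depend on the series. -/
def HasMultiplicity (S : Type u) [AddCommGroup S] [Module A S]
    (M : Type u) [AddCommGroup M] [Module A M] (k : ℕ) : Prop :=
  ∃ s : CompositionSeries (Submodule A M), s.head = ⊥ ∧ s.last = ⊤ ∧
    {i : Fin s.length | Nonempty
      ((↥(s i.succ) ⧸ (s i.castSucc).submoduleOf (s i.succ)) ≃ₗ[A] S)}.ncard = k

/-- `Q` is an injective envelope of `S`: `Q` is injective, and `S` embeds into `Q` as an essential
submodule. -/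
def IsInjectiveEnvelope (S : Type u) [AddCommGroup S] [Module A S]
    (Q : Type u) [AddCommGroup Q] [Module A Q] : Prop :=
  Module.Injective A Q ∧ ∃ f : S →ₗ[A] Q, Function.Injective f ∧
    ∀ N : Submodule A Q, N ⊓ LinearMap.range f = ⊥ → N = ⊥

/-- `M ∈ F(Θ)`: the module `M` is finitely generated and has a finite filtration
`0 = F t ≤ F (t - 1) ≤ ⋯ ≤ F 0 = M` with all factors `F i / F (i + 1)` isomorphic to modules in
the class `Θ`. -/
def HasFiltration (Θ : ModuleCat.{u} A → Prop) (M : ModuleCat.{u} A) : Prop :=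
  Module.Finite A M ∧ ∃ (t : ℕ) (F : ℕ → Submodule A M), F 0 = ⊤ ∧ F t = ⊥ ∧
    ∀ i < t, F (i + 1) ≤ F i ∧
      ∃ X : ModuleCat.{u} A, Θ X ∧ Nonempty ((↥(F i) ⧸ (F (i + 1)).submoduleOf (F i)) ≃ₗ[A] X)

/-- `M ∈ add T`: the module `M` is (isomorphic to) a direct summand of a finite direct sum of
copies of `T`. -/
def IsInAdd (T M : ModuleCat.{u} A) : Prop :=
  ∃ (k : ℕ) (ι : M →ₗ[A] (Fin k → T)) (π : (Fin k → T) →ₗ[A] M), π ∘ₗ ι = LinearMap.id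

/-- There is an exact sequence `0 → X → M 0 → M 1 → ⋯ → M d → 0` with `M 0, …, M d` in the class
`C`. The sequence is continued by the zero modules `M i`, `i > d`. -/
def HasCoresolution (C : ModuleCat.{u} A → Prop) (X : ModuleCat.{u} A) (d : ℕ) : Prop :=
  ∃ (M : ℕ → ModuleCat.{u} A) (φ : X →ₗ[A] M 0) (δ : ∀ i, M i →ₗ[A] M (i + 1)),
    (∀ i ≤ d, C (M i)) ∧ (∀ i, d < i → Subsingleton (M i)) ∧
    Function.Injective φ ∧ Function.Exact φ (δ 0) ∧ ∀ i, Function.Exact (δ i) (δ (i + 1))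

/-- The smallest `d` for which `X` has a coresolution `0 → X → M 0 → ⋯ → M d → 0` by modules in
the class `C` (`⊤` if there is none). -/
noncomputable def coresolutionDim (C : ModuleCat.{u} A → Prop) (X : ModuleCat.{u} A) : ℕ∞ :=
  ⨅ (d : ℕ) (_ : HasCoresolution C X d), (d : ℕ∞)

/-- A primitive idempotent: a nonzero idempotent that is not the sum of two nonzero orthogonal
idempotents. -/
def IsPrimitiveIdempotent (a : A) : Prop :=
  IsIdempotentElem a ∧ a ≠ 0 ∧ ∀ f g : A, IsIdempotentElem f → IsIdempotentElem g →
    f * g = 0 → g * f = 0 → f + g = a → f = 0 ∨ g = 0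

end Modules

section Stratified

variable {A : Type u} [Ring A] {n : ℕ} (e : Fin n → A)

/-- The projective module `P(i) = A eᵢ`. -/
def P (i : Fin n) : Submodule A A := Submodule.span A {e i}

/-- The module `E(i) = P(i) / rad P(i)`, the top of `P(i)`. -/
abbrev E (i : Fin n) : Type u := ↥(P e i) ⧸ Module.jacobson A ↥(P e i)

/-- The standard module `Δ(i)`: the largest factor module of `P(i)` without composition factors
`E(j)`, `j > i`. -/
abbrev Delta (i : Fin n) : Type u :=
  ↥(P e i) ⧸ sInf {N : Submodule A ↥(P e i) |
    ∀ j, i < j → ¬ IsCompositionFactor (A := A) (E e j) (↥(P e i) ⧸ N)}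

/-- The largest submodule of `Q` without composition factors `E(j)`, `j > i`. If `Q` is the
injective envelope of `E(i)`, this is the costandard module `∇(i)`. -/
def nabla (i : Fin n) (Q : Type u) [AddCommGroup Q] [Module A Q] : Submodule A Q :=
  sSup {N : Submodule A Q | ∀ j, i < j → ¬ IsCompositionFactor (A := A) (E e j) ↥N}

/-- The largest submodule of `nabla e i Q` in which `E(i)` has multiplicity one. If `Q` is the
injective envelope of `E(i)`, this is the proper costandard module. -/
def nablaBar (i : Fin n) (Q : Type u) [AddCommGroup Q] [Module A Q] : Submodule A Q :=
  sSup {N : Submodule A Q | N ≤ nabla e i Q ∧ HasMultiplicity (A := A) (E e i) ↥N 1}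

/-- The class of the standard modules, closed under isomorphism. -/
def IsStandard (M : ModuleCat.{u} A) : Prop := ∃ i, Nonempty (M ≃ₗ[A] Delta e i)

/-- The class of the proper costandard modules, closed under isomorphism. -/
def IsProperCostandard (M : ModuleCat.{u} A) : Prop :=
  ∃ (i : Fin n) (Q : ModuleCat.{u} A), IsInjectiveEnvelope (A := A) (E e i) Q ∧
    Nonempty (M ≃ₗ[A] ↥(nablaBar e i Q))

/-- `e₁, …, eₙ` is a complete set of primitive orthogonal idempotents of `A`, and `A` is basic:
the modules `P(i) = A eᵢ` are pairwise non-isomorphic. -/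
structure IsBasicIdempotentSystem : Prop where
  complete : CompleteOrthogonalIdempotents e
  primitive : ∀ i, IsPrimitiveIdempotent (e i)
  basic : ∀ i j, Nonempty (↥(P e i) ≃ₗ[A] ↥(P e j)) → i = j

/-- `(A, ≤)` is standardly stratified: the left regular module is in `F(Δ)`. -/
def IsStandardlyStratified : Prop := HasFiltration (IsStandard e) (ModuleCat.of A A)

/-- `T` is a characteristic module: `add T = F(Δ) ∩ F(∇̄)`. This determines `T` up to the
multiplicities of its indecomposable summands; the basic such module (all multiplicities one) is
a special case, and `add T`, `proj.dim T` do not depend on the choice. -/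
def IsCharacteristicModule (T : ModuleCat.{u} A) : Prop :=
  ∀ M : ModuleCat.{u} A,
    IsInAdd T M ↔ HasFiltration (IsStandard e) M ∧ HasFiltration (IsProperCostandard e) M

/-- The `∇̄`-good filtration dimension of a module. -/
noncomputable def gfd (X : ModuleCat.{u} A) : ℕ∞ :=
  coresolutionDim (HasFiltration (IsProperCostandard e)) X

/-- The `∇̄`-good filtration dimension of the algebra: the supremum over all finitely generated
modules. -/
noncomputable def gfdAlgebra : ℕ∞ :=
  ⨆ (X : ModuleCat.{u} A) (_ : Module.Finite A X), gfd e X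

/-- The `T`-codimension of a module. -/
noncomputable def codim (T X : ModuleCat.{u} A) : ℕ∞ := coresolutionDim (IsInAdd T) X

end Stratified

end StdStrat

/-!
Write `Ext^k(Δ, X) = 0` for the vanishing of all `Ext^k(Δ(i), X)`. All four dimensions are at most
`m` under the same condition on extensions, and this rests on four facts.

* A finitely generated module `Y` is in `F(∇̄)` if and only if `Ext¹(Δ, Y) = 0`
  (`hasFiltration_isProperCostandard_iff`), and then `Ext^k(Δ, Y) = 0` for all `k ≥ 1`
  (`IsDeltaInjective.extVanishes`). The higher extensions vanish because `A ∈ F(Δ)`: the kernel of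
  `P(i) → Δ(i)` is a direct summand of the trace of the `P(j)`, `j > i`, in `A`, and that trace is
  filtered by the `Δ(j)`, `j > i` (`HasFiltration.trace`). This also bounds the projective
  dimensions of the modules in `F(Δ)` (`extVanishes_Delta_of_le`).
* Every finitely generated `X` has an exact sequence `0 → X → Y → Z → 0` with `Y` in `F(∇̄)` and `Z`
  in `F(Δ)`, obtained from universal extensions (`exists_isDeltaInjective_embedding`). If `X` is in
  `F(Δ)`, then `Y` is in `F(Δ) ∩ F(∇̄) = add T`.
* By dimension shifting along these sequences, the `∇̄`-good filtration dimension of `X` is at most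
  `m` if and only if `Ext^(m+1)(Δ, X) = 0` (`gfd_le_iff`), and for `X` in `F(Δ)`, in particular for
  `X = A`, it coincides with the `T`-codimension (`codim_le_of_extVanishes`).
* If `Ext^k(Δ, A) = 0` for all `k > m`, then `proj.dim T ≤ m`, because the last nonzero functor
  `Ext^k(T, -)` is right exact on finitely generated modules
  (`hasProjectiveDimensionLE_of_extVanishes_regular`). If `proj.dim T ≤ m`, then all modules in
  `F(Δ)` have projective dimension at most `m`, because they embed in modules in `add T` with
  cokernels in `F(Δ)` (`extVanishes_of_hasProjectiveDimensionLE`); so the good filtration dimension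
  of every module is at most `m`.

Composition factors are handled through idempotents: `E(j)` is a composition factor of `M` if and
only if `eⱼ M ≠ 0` (`isCompositionFactor_iff`), and `mem_nablaBar_iff` describes the proper
costandard modules in the same way. This makes it unnecessary to know beforehand that injective
envelopes of simple modules are finitely generated.
-/

namespace StdStrat

/-! ### Vanishing of extension groups -/

section Ext

open Abelian

variable {A : Type u} [Ring A]
variable {L : Type u} [AddCommGroup L] [Module A L] {M : Type u} [AddCommGroup M] [Module A M]
  {N : Type u} [AddCommGroup N] [Module A N] {Y : Type u} [AddCommGroup Y] [Module A Y]

variable (A) in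
/-- `Ext^k_A(M, N) = 0`, for unbundled modules. -/
def ExtVanishes (k : ℕ) (M : Type u) [AddCommGroup M] [Module A M]
    (N : Type u) [AddCommGroup N] [Module A N] : Prop :=
  Subsingleton (Ext (ModuleCat.of A M) (ModuleCat.of A N) k)

theorem shortExact_of_linearMap {f : L →ₗ[A] M} {g : M →ₗ[A] N} (hf : Function.Injective f)
    (hfg : Function.Exact f g) (hg : Function.Surjective g) :
    (ShortComplex.mk (ModuleCat.ofHom f) (ModuleCat.ofHom g)
      (by ext x; exact hfg.apply_apply_eq_zero x)).ShortExact := by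
  apply ModuleCat.shortComplex_shortExact
  · exact hfg
  · exact hf
  · exact hg

namespace ExtVanishes

theorem covariant_middle {f : L →ₗ[A] M} {g : M →ₗ[A] N} (hf : Function.Injective f)
    (hfg : Function.Exact f g) (hg : Function.Surjective g) {k : ℕ}
    (h₁ : ExtVanishes A k Y L) (h₃ : ExtVanishes A k Y N) : ExtVanishes A k Y M := by
  have hS := shortExact_of_linearMap hf hfg hg
  unfold ExtVanishes at *
  refine subsingleton_of_forall_eq 0 fun x => ?_
  obtain ⟨y, rfl⟩ := Ext.covariant_sequence_exact₂ _ hS x (h₃.elim _ _)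
  rw [h₁.elim y 0, Ext.zero_comp]

theorem covariant_right {f : L →ₗ[A] M} {g : M →ₗ[A] N} (hf : Function.Injective f)
    (hfg : Function.Exact f g) (hg : Function.Surjective g) {k : ℕ}
    (h₂ : ExtVanishes A k Y M) (h₁ : ExtVanishes A (k + 1) Y L) : ExtVanishes A k Y N := by
  have hS := shortExact_of_linearMap hf hfg hg
  unfold ExtVanishes at *
  refine subsingleton_of_forall_eq 0 fun x => ?_
  obtain ⟨y, rfl⟩ := Ext.covariant_sequence_exact₃ _ hS x rfl (h₁.elim _ _)
  rw [h₂.elim y 0, Ext.zero_comp]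

theorem covariant_left {f : L →ₗ[A] M} {g : M →ₗ[A] N} (hf : Function.Injective f)
    (hfg : Function.Exact f g) (hg : Function.Surjective g) {k : ℕ}
    (h₃ : ExtVanishes A k Y N) (h₂ : ExtVanishes A (k + 1) Y M) : ExtVanishes A (k + 1) Y L := by
  have hS := shortExact_of_linearMap hf hfg hg
  unfold ExtVanishes at *
  refine subsingleton_of_forall_eq 0 fun x => ?_
  obtain ⟨y, rfl⟩ := Ext.covariant_sequence_exact₁ _ hS x (h₂.elim _ _) rfl
  rw [h₃.elim y 0, Ext.zero_comp]

theorem contravariant_middle {f : L →ₗ[A] M} {g : M →ₗ[A] N} (hf : Function.Injective f)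
    (hfg : Function.Exact f g) (hg : Function.Surjective g) {k : ℕ}
    (h₁ : ExtVanishes A k L Y) (h₃ : ExtVanishes A k N Y) : ExtVanishes A k M Y := by
  have hS := shortExact_of_linearMap hf hfg hg
  unfold ExtVanishes at *
  refine subsingleton_of_forall_eq 0 fun x => ?_
  obtain ⟨y, rfl⟩ := Ext.contravariant_sequence_exact₂ hS _ x (h₁.elim _ _)
  rw [h₃.elim y 0, Ext.comp_zero]

theorem contravariant_right {f : L →ₗ[A] M} {g : M →ₗ[A] N} (hf : Function.Injective f)
    (hfg : Function.Exact f g) (hg : Function.Surjective g) {k : ℕ}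
    (h₁ : ExtVanishes A k L Y) (h₂ : ExtVanishes A (k + 1) M Y) : ExtVanishes A (k + 1) N Y := by
  have hS := shortExact_of_linearMap hf hfg hg
  unfold ExtVanishes at *
  refine subsingleton_of_forall_eq 0 fun x => ?_
  obtain ⟨y, rfl⟩ := Ext.contravariant_sequence_exact₃ hS _ x (h₂.elim _ _) (add_comm 1 k)
  rw [h₁.elim y 0, Ext.comp_zero]

theorem contravariant_left {f : L →ₗ[A] M} {g : M →ₗ[A] N} (hf : Function.Injective f)
    (hfg : Function.Exact f g) (hg : Function.Surjective g) {k : ℕ}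
    (h₂ : ExtVanishes A k M Y) (h₃ : ExtVanishes A (k + 1) N Y) : ExtVanishes A k L Y := by
  have hS := shortExact_of_linearMap hf hfg hg
  unfold ExtVanishes at *
  refine subsingleton_of_forall_eq 0 fun x => ?_
  obtain ⟨y, rfl⟩ := Ext.contravariant_sequence_exact₁ hS _ x (add_comm 1 k) (h₃.elim _ _)
  rw [h₂.elim y 0, Ext.comp_zero]

theorem of_projective [Module.Projective A M] (k : ℕ) : ExtVanishes A (k + 1) M N := by
  unfold ExtVanishes
  have : Projective (ModuleCat.of A M) := (IsProjective.iff_projective M).1 inferInstance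
  exact subsingleton_of_forall_eq 0 Ext.eq_zero_of_projective

theorem of_injective (h : Module.Injective A N) (k : ℕ) : ExtVanishes A (k + 1) M N := by
  unfold ExtVanishes
  have : Injective (ModuleCat.of A N) := (Module.injective_iff_injective_object A N).1 h
  exact subsingleton_of_forall_eq 0 Ext.eq_zero_of_injective

theorem zero_iff : ExtVanishes A 0 M N ↔ ∀ f : M →ₗ[A] N, f = 0 := by
  unfold ExtVanishes
  rw [Ext.addEquiv₀.subsingleton_congr, (ModuleCat.homEquiv (R := A)).subsingleton_congr]
  exact ⟨fun h f => h.elim _ _, fun h => subsingleton_of_forall_eq 0 h⟩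

/-- Vanishing of `Ext^k(-, Y)` passes to retracts. -/
theorem retract_left {k : ℕ} (h : ExtVanishes A k M Y) (i : N →ₗ[A] M) (r : M →ₗ[A] N)
    (hr : r ∘ₗ i = LinearMap.id) : ExtVanishes A k N Y := by
  unfold ExtVanishes at *
  refine subsingleton_of_forall_eq 0 fun x => ?_
  have e : (Ext.mk₀ (ModuleCat.ofHom i)).comp ((Ext.mk₀ (ModuleCat.ofHom r)).comp x (zero_add k))
      (zero_add k) = x := by
    rw [Ext.mk₀_comp_mk₀_assoc, ← ModuleCat.ofHom_comp, hr, ModuleCat.ofHom_id, Ext.mk₀_id_comp]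
  rw [← e, h.elim (Ext.comp _ _ _) 0, Ext.comp_zero]

theorem congr_left {k : ℕ} (h : ExtVanishes A k M Y) (i : N ≃ₗ[A] M) : ExtVanishes A k N Y :=
  h.retract_left i.toLinearMap i.symm.toLinearMap (by ext; simp)

theorem congr_right {k : ℕ} (h : ExtVanishes A k Y M) (i : M ≃ₗ[A] N) : ExtVanishes A k Y N := by
  unfold ExtVanishes at *
  refine subsingleton_of_forall_eq 0 fun x => ?_
  have e : (x.comp (Ext.mk₀ (ModuleCat.ofHom i.symm.toLinearMap)) (add_zero k)).comp
      (Ext.mk₀ (ModuleCat.ofHom i.toLinearMap)) (add_zero k) = x := by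
    rw [Ext.comp_assoc_of_third_deg_zero, Ext.mk₀_comp_mk₀, ← ModuleCat.ofHom_comp]
    simp
  rw [← e, h.elim (x.comp _ _) 0, Ext.zero_comp]

theorem of_subsingleton_left [Subsingleton M] (k : ℕ) : ExtVanishes A k M Y := by
  cases k with
  | zero => exact zero_iff.2 fun f => by ext x; simp [Subsingleton.elim x 0]
  | succ k =>
    have : Module.Projective A M := Module.Projective.of_basis (Module.Basis.empty M (ι := Empty))
    exact of_projective k

theorem of_subsingleton_right [Subsingleton Y] (k : ℕ) : ExtVanishes A k M Y := by
  cases k with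
  | zero => exact zero_iff.2 fun f => by ext x; exact Subsingleton.elim _ _
  | succ k =>
    exact of_injective ⟨fun _ _ _ _ _ _ _ _ _ => ⟨0, fun _ => Subsingleton.elim _ _⟩⟩ k

theorem injective_single (N : Type u) [AddCommGroup N] [Module A N] (m : ℕ) :
    Function.Injective (LinearMap.single A (fun _ : Fin (m + 1) => N) 0) :=
  fun _ _ h => by simpa using congrFun h 0

/-- The exact sequence `0 → N → N^(m+1) → N^m → 0`, for inductions over finite direct sums. -/
theorem exact_single_tail (N : Type u) [AddCommGroup N] [Module A N] (m : ℕ) :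
    Function.Exact (LinearMap.single A (fun _ : Fin (m + 1) => N) 0)
      (LinearMap.funLeft A N (Fin.succ : Fin m → Fin (m + 1))) := by
  intro x
  constructor
  · intro h
    refine ⟨x 0, ?_⟩
    ext i
    cases i using Fin.cases with
    | zero => simp
    | succ i => simpa using (congrFun h i).symm
  · rintro ⟨y, rfl⟩
    ext i
    simp [LinearMap.funLeft_apply]

theorem surjective_tail (N : Type u) [AddCommGroup N] [Module A N] (m : ℕ) :
    Function.Surjective (LinearMap.funLeft A N (Fin.succ : Fin m → Fin (m + 1))) :=
  LinearMap.funLeft_surjective_of_injective _ _ _ (Fin.succ_injective _)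

theorem pi_left {k : ℕ} (h : ExtVanishes A k M Y) (m : ℕ) : ExtVanishes A k (Fin m → M) Y := by
  induction m with
  | zero => exact of_subsingleton_left k
  | succ m ih =>
    exact contravariant_middle (injective_single _ m) (exact_single_tail M m)
      (surjective_tail M m) h ih

theorem pi_right {k : ℕ} (h : ExtVanishes A k Y M) (m : ℕ) : ExtVanishes A k Y (Fin m → M) := by
  induction m with
  | zero => exact of_subsingleton_right k
  | succ m ih =>
    exact covariant_middle (injective_single _ m) (exact_single_tail M m)
      (surjective_tail M m) h ih

/-- If `Ext¹(N, Y) = 0`, maps to `Y` extend along a monomorphism with cokernel `N`. -/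
theorem exists_extension {f : L →ₗ[A] M} {g : M →ₗ[A] N} (hf : Function.Injective f)
    (hfg : Function.Exact f g) (hg : Function.Surjective g) (h : ExtVanishes A 1 N Y)
    (φ : L →ₗ[A] Y) : ∃ ψ : M →ₗ[A] Y, ψ ∘ₗ f = φ := by
  have hS := shortExact_of_linearMap hf hfg hg
  unfold ExtVanishes at h
  obtain ⟨x, hx⟩ := Ext.contravariant_sequence_exact₁ hS (ModuleCat.of A Y)
    (Ext.mk₀ (ModuleCat.ofHom φ)) (add_zero 1) (h.elim _ _)
  obtain ⟨ψ, rfl⟩ := (Ext.mk₀_bijective _ _).2 x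
  rw [Ext.mk₀_comp_mk₀] at hx
  exact ⟨ψ.hom, congrArg ModuleCat.Hom.hom ((Ext.mk₀_bijective _ _).1 hx)⟩

/-- If `M` is projective and every map `L → Y` extends to `M`, then `Ext¹(M / L, Y) = 0`. -/
theorem one_of_extension [Module.Projective A M] {f : L →ₗ[A] M} {g : M →ₗ[A] N}
    (hf : Function.Injective f) (hfg : Function.Exact f g) (hg : Function.Surjective g)
    (h : ∀ φ : L →ₗ[A] Y, ∃ ψ : M →ₗ[A] Y, ψ ∘ₗ f = φ) : ExtVanishes A 1 N Y := by
  have hS := shortExact_of_linearMap hf hfg hg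
  have hM : ExtVanishes A 1 M Y := of_projective 0
  unfold ExtVanishes at *
  refine subsingleton_of_forall_eq 0 fun x => ?_
  obtain ⟨y, rfl⟩ := Ext.contravariant_sequence_exact₃ hS _ x (hM.elim _ _) (add_zero 1)
  obtain ⟨φ, rfl⟩ := (Ext.mk₀_bijective _ _).2 y
  obtain ⟨ψ, hψ⟩ := h φ.hom
  have e : φ = ModuleCat.ofHom f ≫ ModuleCat.ofHom ψ := ModuleCat.hom_ext hψ.symm
  subst e
  rw [← Ext.mk₀_comp_mk₀]
  exact hS.extClass_comp_assoc _

end ExtVanishes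

/-- Over a left Noetherian ring, the projective dimension of a finitely generated module is
detected by its extensions with finitely generated modules. -/
theorem hasProjectiveDimensionLE_of_extVanishes [IsNoetherianRing A] (m : ℕ) :
    ∀ (M : Type u) [AddCommGroup M] [Module A M] [Module.Finite A M],
      (∀ (N : Type u) [AddCommGroup N] [Module A N] [Module.Finite A N],
        ExtVanishes A (m + 1) M N) → HasProjectiveDimensionLE (ModuleCat.of A M) m := by
  induction m with
  | zero =>
    intro M _ _ _ h
    obtain ⟨k, p, hp⟩ := Module.Finite.exists_fin' A M
    obtain ⟨s, hs⟩ := (h (LinearMap.ker p)).exists_extension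
      (f := (LinearMap.ker p).subtype) (g := p) (Submodule.injective_subtype _)
      (by intro x; simp) hp LinearMap.id
    rw [← projective_iff_hasProjectiveDimensionLE_zero, ← IsProjective.iff_projective]
    -- A retraction onto the kernel makes `M` a direct summand of a free module.
    have hs' : ∀ x (hx : p x = 0), (s x : Fin k → A) = x := fun x hx =>
      congrArg Subtype.val (LinearMap.congr_fun hs ⟨x, hx⟩)
    let q : (Fin k → A) →ₗ[A] (Fin k → A) := LinearMap.id - (LinearMap.ker p).subtype ∘ₗ s
    have hq : LinearMap.ker p ≤ LinearMap.ker q := fun x hx => by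
      simp [q, hs' x hx]
    let t : M →ₗ[A] (Fin k → A) :=
      (LinearMap.ker p).liftQ q hq ∘ₗ (p.quotKerEquivOfSurjective hp).symm.toLinearMap
    refine Module.Projective.of_split t p ?_
    ext y
    obtain ⟨x, rfl⟩ := hp y
    have : (p.quotKerEquivOfSurjective hp).symm (p x) = Submodule.Quotient.mk x := by
      rw [LinearEquiv.symm_apply_eq]; rfl
    simp [t, this, q]
  | succ m ih =>
    intro M _ _ _ h
    obtain ⟨k, p, hp⟩ := Module.Finite.exists_fin' A M
    have hfg : Function.Exact (LinearMap.ker p).subtype p := by intro x; simp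
    have hK : HasProjectiveDimensionLE (ModuleCat.of A (LinearMap.ker p)) m :=
      ih _ fun N _ _ _ => ExtVanishes.contravariant_left (Submodule.injective_subtype _) hfg hp
        (ExtVanishes.of_projective m) (h N)
    have hS := shortExact_of_linearMap (Submodule.injective_subtype _) hfg hp
    have : Projective (ModuleCat.of A (Fin k → A)) :=
      (IsProjective.iff_projective (Fin k → A)).1 inferInstance
    exact (hS.hasProjectiveDimensionLT_X₃_iff m this).2 hK

end Ext

/-! ### Filtrations -/

section Filtrations

variable {A : Type u} [Ring A]

theorem nonempty_quotient_equiv {P X : Type*} [AddCommGroup P] [Module A P] [AddCommGroup X]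
    [Module A X] {K : Submodule A P} (φ : P →ₗ[A] X) (hφ : Function.Surjective φ)
    (hK : ∀ x, φ x = 0 ↔ x ∈ K) : Nonempty ((P ⧸ K) ≃ₗ[A] X) :=
  ⟨(Submodule.quotEquivOfEq _ _ (by ext x; simp [hK])).trans
    (φ.quotKerEquivOfSurjective hφ)⟩

theorem finite_of_exact {L M N : Type*} [AddCommGroup L] [Module A L] [AddCommGroup M] [Module A M]
    [AddCommGroup N] [Module A N] {f : L →ₗ[A] M} {g : M →ₗ[A] N}
    (hfg : Function.Exact f g) (hg : Function.Surjective g)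
    (hL : Module.Finite A L) (hN : Module.Finite A N) : Module.Finite A M := by
  have : Module.Finite A (LinearMap.range f) := inferInstance
  have e := LinearMap.exact_iff.1 hfg
  have : Module.Finite A (LinearMap.ker g) := by rw [e]; infer_instance
  have : Module.Finite A (M ⧸ LinearMap.ker g) :=
    Module.Finite.equiv (g.quotKerEquivOfSurjective hg).symm
  exact Module.Finite.of_submodule_quotient (LinearMap.ker g)

variable {Θ : ModuleCat.{u} A → Prop}

theorem HasFiltration.of_subsingleton (M : Type u) [AddCommGroup M] [Module A M]
    [Subsingleton M] : HasFiltration Θ (ModuleCat.of A M) :=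
  ⟨inferInstanceAs (Module.Finite A M), 0, fun _ => ⊤, rfl,
    (Submodule.eq_bot_of_subsingleton (p := (⊤ : Submodule A M))), by simp⟩

/-- Put one more factor on top of a filtration. -/
theorem HasFiltration.step {L M N : Type u} [AddCommGroup L] [Module A L] [AddCommGroup M]
    [Module A M] [AddCommGroup N] [Module A N] {f : L →ₗ[A] M} {g : M →ₗ[A] N}
    (hf : Function.Injective f) (hfg : Function.Exact f g) (hg : Function.Surjective g)
    (hL : HasFiltration Θ (ModuleCat.of A L)) (hN : Θ (ModuleCat.of A N))
    (hM : Module.Finite A M) : HasFiltration Θ (ModuleCat.of A M) := by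
  obtain ⟨-, t, F, hF0, hFt, hF⟩ := hL
  refine ⟨hM, t + 1, fun i => Nat.casesOn i ⊤ fun i => (F i).map f, rfl, ?_, ?_⟩
  · change (F t).map f = ⊥
    rw [hFt, Submodule.map_bot]
  rintro (_ | i) hi
  · refine ⟨le_top, _, hN, ?_⟩
    refine nonempty_quotient_equiv (g ∘ₗ Submodule.subtype _) ?_ ?_
    · intro y
      obtain ⟨x, rfl⟩ := hg y
      exact ⟨⟨x, trivial⟩, rfl⟩
    · rintro ⟨x, -⟩
      change g x = 0 ↔ x ∈ (F 0).map f
      rw [hF0, Submodule.map_top]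
      exact hfg x
  · obtain ⟨hle, X, hX, ⟨e⟩⟩ := hF i (by omega)
    refine ⟨Submodule.map_mono hle, X, hX, ?_⟩
    let q := Submodule.equivMapOfInjective f hf (F i)
    refine nonempty_quotient_equiv
      (e.toLinearMap ∘ₗ Submodule.mkQ _ ∘ₗ q.symm.toLinearMap) ?_ ?_
    · exact e.surjective.comp ((Submodule.mkQ_surjective _).comp q.symm.surjective)
    · intro x
      obtain ⟨y, rfl⟩ := q.surjective x
      simp only [LinearMap.comp_apply, LinearEquiv.coe_coe, LinearEquiv.symm_apply_apply,
        LinearEquiv.map_eq_zero_iff, Submodule.mkQ_apply, Submodule.Quotient.mk_eq_zero]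
      change (y : L) ∈ F (i + 1) ↔ f y ∈ (F (i + 1)).map f
      exact ⟨fun h => ⟨_, h, rfl⟩, fun ⟨z, hz, e⟩ => hf e ▸ hz⟩

/-- Induction over the factors of a filtration, from the bottom to the top. -/
theorem HasFiltration.induction [IsNoetherianRing A] {p : ModuleCat.{u} A → Prop}
    (zero : ∀ M : ModuleCat.{u} A, Subsingleton M → p M)
    (step : ∀ (L M N : ModuleCat.{u} A) (f : L →ₗ[A] M) (g : M →ₗ[A] N), Function.Injective f →
      Function.Exact f g → Function.Surjective g → Module.Finite A M → p L → Θ N → p M)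
    {M : ModuleCat.{u} A} (h : HasFiltration Θ M) : p M := by
  obtain ⟨hM, t, F, hF0, hFt, hF⟩ := h
  have hfac : ∀ i < t, ∃ (X : ModuleCat.{u} A) (g : F i →ₗ[A] X), Θ X ∧
      Function.Surjective g ∧ ∀ x, g x = 0 ↔ (x : M) ∈ F (i + 1) := by
    intro i hi
    obtain ⟨-, X, hX, ⟨e⟩⟩ := hF i hi
    refine ⟨X, e.toLinearMap ∘ₗ Submodule.mkQ _, hX,
      e.surjective.comp (Submodule.mkQ_surjective _), fun x => ?_⟩
    simp only [LinearMap.comp_apply, LinearEquiv.coe_coe, LinearEquiv.map_eq_zero_iff,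
      Submodule.mkQ_apply, Submodule.Quotient.mk_eq_zero]
    rfl
  have key : ∀ i ≤ t, p (ModuleCat.of A (F i)) := by
    intro i hi
    induction hi using Nat.decreasingInduction with
    | self => exact zero _ (by rw [hFt]; exact inferInstanceAs (Subsingleton (⊥ : Submodule A M)))
    | of_succ i hi ih =>
      obtain ⟨X, g, hX, hg, hk⟩ := hfac i hi
      refine step _ (ModuleCat.of A (F i)) X (Submodule.inclusion (hF i hi).1) g
        (Submodule.inclusion_injective _) (fun x => ?_) hg (inferInstanceAs (Module.Finite A (F i)))
        ih hX
      rw [hk]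
      exact ⟨fun h => ⟨⟨x, h⟩, rfl⟩, by rintro ⟨y, rfl⟩; exact y.2⟩
  rcases Nat.eq_zero_or_pos t with rfl | ht
  · refine zero M ?_
    have : (⊤ : Submodule A M) = ⊥ := hF0.symm.trans hFt
    exact (Submodule.subsingleton_iff A).1 (subsingleton_of_bot_eq_top this.symm)
  · obtain ⟨X, g, hX, hg, hk⟩ := hfac 0 ht
    let j : M →ₗ[A] F 0 := LinearMap.codRestrict (F 0) LinearMap.id (by simp [hF0])
    refine step _ M X (F 1).subtype (g ∘ₗ j) (Submodule.injective_subtype _) (fun x => ?_)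
      (hg.comp fun x => ⟨x, rfl⟩) hM (key 1 ht) hX
    rw [LinearMap.comp_apply, hk]
    simp [j]

theorem HasFiltration.congr [IsNoetherianRing A] {M N : Type u} [AddCommGroup M] [Module A M]
    [AddCommGroup N] [Module A N] (h : HasFiltration Θ (ModuleCat.of A M)) (e : M ≃ₗ[A] N) :
    HasFiltration Θ (ModuleCat.of A N) := by
  have key : ∀ N : ModuleCat.{u} A, (M ≃ₗ[A] N) → HasFiltration Θ N := by
    refine HasFiltration.induction (M := ModuleCat.of A M)
      (p := fun M => ∀ N : ModuleCat.{u} A, (M ≃ₗ[A] N) → HasFiltration Θ N) ?_ ?_ h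
    · intro M _ N e
      have := e.symm.toEquiv.subsingleton
      exact HasFiltration.of_subsingleton N
    · intro L M X f g hf hfg hg hM hL hX N e
      refine HasFiltration.step (f := e.toLinearMap ∘ₗ f) (g := g ∘ₗ e.symm.toLinearMap)
        (e.injective.comp hf) (fun x => ?_) (hg.comp e.symm.surjective)
        (hL _ (LinearEquiv.refl A L)) hX (Module.Finite.equiv e)
      obtain ⟨y, rfl⟩ := e.surjective x
      simpa using hfg y
  exact key (ModuleCat.of A N) e

/-- The modules with a filtration are closed under extensions. -/
theorem HasFiltration.extension [IsNoetherianRing A] {L M N : Type u} [AddCommGroup L] [Module A L]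
    [AddCommGroup M] [Module A M] [AddCommGroup N] [Module A N] {f : L →ₗ[A] M} {g : M →ₗ[A] N}
    (hf : Function.Injective f) (hfg : Function.Exact f g) (hg : Function.Surjective g)
    (hL : HasFiltration Θ (ModuleCat.of A L)) (hN : HasFiltration Θ (ModuleCat.of A N)) :
    HasFiltration Θ (ModuleCat.of A M) := by
  have key : ∀ (M : ModuleCat.{u} A) (f : L →ₗ[A] M) (g : M →ₗ[A] N), Function.Injective f →
      Function.Exact f g → Function.Surjective g → HasFiltration Θ M := by
    refine HasFiltration.induction (M := ModuleCat.of A N)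
      (p := fun N => ∀ (M : ModuleCat.{u} A) (f : L →ₗ[A] M) (g : M →ₗ[A] N),
        Function.Injective f → Function.Exact f g → Function.Surjective g → HasFiltration Θ M)
      ?_ ?_ hN
    · intro N _ M f g hf hfg hg
      refine hL.congr (LinearEquiv.ofBijective f ⟨hf, fun x => ?_⟩)
      exact (hfg x).1 (Subsingleton.elim _ _)
    · intro K N X i p hi hip hp hNfin ih hX M f g hf hfg hg
      -- The preimage of `K` in `M` is an extension of `K` by `L`, with cokernel `X`.
      let U : Submodule A M := (LinearMap.range i).comap g
      have hfU : ∀ x, f x ∈ U := fun x => by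
        simp [U, hfg.apply_apply_eq_zero]
      let eK := LinearEquiv.ofInjective i hi
      let gU : U →ₗ[A] K := eK.symm.toLinearMap ∘ₗ
        LinearMap.codRestrict (LinearMap.range i) (g ∘ₗ U.subtype) fun x => x.2
      have hgU : ∀ x, i (gU x) = g x := fun x => by
        have := congrArg Subtype.val (eK.apply_symm_apply
          (LinearMap.codRestrict (LinearMap.range i) (g ∘ₗ U.subtype) (fun x => x.2) x))
        exact this
      have hU : HasFiltration Θ (ModuleCat.of A U) := by
        refine ih (ModuleCat.of A U) (LinearMap.codRestrict U f hfU) gU ?_ ?_ ?_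
        · intro a b hab
          exact hf (congrArg Subtype.val hab)
        · intro x
          rw [← hi.eq_iff, hgU, map_zero]
          refine (hfg x).trans ⟨?_, ?_⟩
          · rintro ⟨y, hy⟩; exact ⟨y, Subtype.ext hy⟩
          · rintro ⟨y, rfl⟩; exact ⟨y, rfl⟩
        · intro y
          obtain ⟨x, hx⟩ := hg (i y)
          exact ⟨⟨x, y, hx.symm⟩, hi ((hgU _).trans hx)⟩
      refine HasFiltration.step (f := U.subtype) (g := p ∘ₗ g) (Submodule.injective_subtype _)
        (fun x => ?_) (hp.comp hg) hU hX (finite_of_exact hfg hg hL.1 hNfin)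
      rw [LinearMap.comp_apply, hip (g x)]
      simp [U]
  exact key (ModuleCat.of A M) f g hf hfg hg

theorem HasFiltration.pi [IsNoetherianRing A] {M : Type u} [AddCommGroup M] [Module A M]
    (h : HasFiltration Θ (ModuleCat.of A M)) (m : ℕ) :
    HasFiltration Θ (ModuleCat.of A (Fin m → M)) := by
  induction m with
  | zero => exact HasFiltration.of_subsingleton _
  | succ m ih =>
    exact HasFiltration.extension (ExtVanishes.injective_single M m)
      (ExtVanishes.exact_single_tail M m) (ExtVanishes.surjective_tail M m) h ih

theorem HasFiltration.of_mem [IsNoetherianRing A] {M : Type u} [AddCommGroup M] [Module A M]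
    (hM : Module.Finite A M) (h : Θ (ModuleCat.of A M)) : HasFiltration Θ (ModuleCat.of A M) :=
  HasFiltration.step (L := PUnit) (f := 0) (g := LinearMap.id)
    (Function.injective_of_subsingleton _) (fun x => by simp [eq_comm])
    Function.surjective_id (HasFiltration.of_subsingleton _) h hM

theorem HasFiltration.extVanishes_left [IsNoetherianRing A] {M Y : Type u} [AddCommGroup M]
    [Module A M] [AddCommGroup Y] [Module A Y] (hM : HasFiltration Θ (ModuleCat.of A M)) {k : ℕ}
    (h : ∀ X, Θ X → ExtVanishes A k X Y) : ExtVanishes A k M Y :=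
  HasFiltration.induction (p := fun M => ExtVanishes A k M Y)
    (fun _ _ => ExtVanishes.of_subsingleton_left k)
    (fun _ _ _ _ _ hf hfg hg _ hL hX => ExtVanishes.contravariant_middle hf hfg hg hL (h _ hX)) hM

theorem HasFiltration.extVanishes_right [IsNoetherianRing A] {M Y : Type u} [AddCommGroup M]
    [Module A M] [AddCommGroup Y] [Module A Y] (hM : HasFiltration Θ (ModuleCat.of A M)) {k : ℕ}
    (h : ∀ X, Θ X → ExtVanishes A k Y X) : ExtVanishes A k Y M :=
  HasFiltration.induction (p := fun M => ExtVanishes A k Y M)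
    (fun _ _ => ExtVanishes.of_subsingleton_right k)
    (fun _ _ _ _ _ hf hfg hg _ hL hX => ExtVanishes.covariant_middle hf hfg hg hL (h _ hX)) hM

end Filtrations

/-! ### Coresolutions -/

section Coresolutions

variable {A : Type u} [Ring A] {C : ModuleCat.{u} A → Prop}

theorem HasCoresolution.mono {C' : ModuleCat.{u} A → Prop} (hC : ∀ M, C M → C' M)
    {X : ModuleCat.{u} A} {d : ℕ} (h : HasCoresolution C X d) : HasCoresolution C' X d := by
  obtain ⟨M, φ, δ, hM, h⟩ := h
  exact ⟨M, φ, δ, fun i hi => hC _ (hM i hi), h⟩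

/-- The sequence of modules `M, N 0, N 1, …`. -/
def consModule (M : ModuleCat.{u} A) (N : ℕ → ModuleCat.{u} A) : ℕ → ModuleCat.{u} A
  | 0 => M
  | i + 1 => N i

/-- The sequence of maps `f, δ 0, δ 1, …` between the modules `M, N 0, N 1, …`. -/
def consMap {M : ModuleCat.{u} A} {N : ℕ → ModuleCat.{u} A} (f : M →ₗ[A] N 0)
    (δ : ∀ i, N i →ₗ[A] N (i + 1)) : ∀ i, consModule M N i →ₗ[A] consModule M N (i + 1)
  | 0 => f
  | i + 1 => δ i

theorem HasCoresolution.zero {X : ModuleCat.{u} A} (h : C X) : HasCoresolution C X 0 := by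
  refine ⟨consModule X fun _ => ModuleCat.of A PUnit, LinearMap.id (M := X),
    consMap 0 fun _ => 0, ?_, ?_, Function.injective_id, ?_, ?_⟩
  · intro i hi
    obtain rfl : i = 0 := by omega
    exact h
  · rintro (_ | i) hi
    · omega
    · exact inferInstanceAs (Subsingleton PUnit)
  · exact fun x => ⟨fun _ => ⟨x, rfl⟩, fun _ => rfl⟩
  · rintro (_ | i) x
    · exact ⟨fun _ => ⟨(0 : X), Subsingleton.elim (α := PUnit) _ _⟩, fun _ => rfl⟩
    · exact ⟨fun _ => ⟨PUnit.unit, Subsingleton.elim (α := PUnit) _ _⟩, fun _ => rfl⟩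

/-- Splice `0 → X → M → Z → 0` with a coresolution of `Z`. -/
theorem HasCoresolution.succ {X M Z : ModuleCat.{u} A} {f : X →ₗ[A] M} {g : M →ₗ[A] Z}
    (hf : Function.Injective f) (hfg : Function.Exact f g) (hg : Function.Surjective g) (hM : C M)
    {d : ℕ} (h : HasCoresolution C Z d) : HasCoresolution C X (d + 1) := by
  obtain ⟨N, φ, δ, hN, hN', hφ, hφδ, hδ⟩ := h
  refine ⟨consModule M N, f, consMap (φ ∘ₗ g) δ, ?_, ?_, hf, ?_, ?_⟩
  · rintro (_ | i) hi
    · exact hM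
    · exact hN i (by omega)
  · rintro (_ | i) hi
    · omega
    · exact hN' i (by omega)
  · intro x
    refine Iff.trans ?_ (hfg x)
    change φ (g x) = 0 ↔ _
    rw [map_eq_zero_iff φ hφ]
  · rintro (_ | i)
    · intro x
      refine (hφδ x).trans ⟨?_, ?_⟩
      · rintro ⟨y, rfl⟩
        obtain ⟨z, rfl⟩ := hg y
        exact ⟨z, rfl⟩
      · rintro ⟨z, rfl⟩
        exact ⟨g z, rfl⟩
    · exact hδ i

theorem HasCoresolution.exists_equiv {X : ModuleCat.{u} A} (h : HasCoresolution C X 0) :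
    ∃ M : ModuleCat.{u} A, C M ∧ Nonempty (X ≃ₗ[A] M) := by
  obtain ⟨M, φ, δ, hM, hM', hφ, hφδ, hδ⟩ := h
  refine ⟨M 0, hM 0 le_rfl, ⟨LinearEquiv.ofBijective φ ⟨hφ, fun x => ?_⟩⟩⟩
  have := hM' 1 one_pos
  exact (hφδ x).1 (Subsingleton.elim _ _)

theorem HasCoresolution.exists_exact {X : ModuleCat.{u} A} {d : ℕ}
    (h : HasCoresolution C X (d + 1)) :
    ∃ (M Z : ModuleCat.{u} A) (f : X →ₗ[A] M) (g : M →ₗ[A] Z), Function.Injective f ∧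
      Function.Exact f g ∧ Function.Surjective g ∧ C M ∧ HasCoresolution C Z d := by
  obtain ⟨M, φ, δ, hM, hM', hφ, hφδ, hδ⟩ := h
  have hr : LinearMap.range (δ 0) = LinearMap.ker (δ 1) := (LinearMap.exact_iff.1 (hδ 0)).symm
  refine ⟨M 0, ModuleCat.of A (LinearMap.range (δ 0)), φ, (δ 0).rangeRestrict, hφ, fun x => ?_,
    LinearMap.surjective_rangeRestrict _, hM 0 (Nat.zero_le _),
    fun i => M (i + 1), (LinearMap.range (δ 0)).subtype, fun i => δ (i + 1),
    fun i hi => hM _ (by omega), fun i hi => hM' _ (by omega), Submodule.injective_subtype _,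
    fun x => ?_, fun i => hδ (i + 1)⟩
  · rw [← hφδ x, Subtype.ext_iff]
    rfl
  · refine (hδ 0 x).trans ?_
    constructor
    · intro h
      exact ⟨⟨x, h⟩, rfl⟩
    · rintro ⟨y, rfl⟩
      exact y.2

/-- A module with a `C`-coresolution of length `d`, where `Ext^{> 0}(Y, C) = 0`, has no
extensions by `Y` in degrees above `d`. -/
theorem HasCoresolution.extVanishes {Y : Type u} [AddCommGroup Y] [Module A Y]
    (hC : ∀ M, C M → ∀ k, ExtVanishes A (k + 1) Y M) {d : ℕ} :
    ∀ {X : ModuleCat.{u} A}, HasCoresolution C X d → ∀ k, ExtVanishes A (d + k + 1) Y X := by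
  induction d with
  | zero =>
    intro X h k
    obtain ⟨M, hM, ⟨e⟩⟩ := h.exists_equiv
    have := (hC M hM k).congr_right e.symm
    rwa [Nat.zero_add]
  | succ d ih =>
    intro X h k
    obtain ⟨M, Z, f, g, hf, hfg, hg, hM, hZ⟩ := h.exists_exact
    have := ExtVanishes.covariant_left hf hfg hg (ih hZ k) (hC M hM (d + k + 1))
    rwa [show d + 1 + k + 1 = d + k + 1 + 1 by omega]

theorem coresolutionDim_le_iff {X : ModuleCat.{u} A} {m : ℕ} :
    coresolutionDim C X ≤ m ↔ ∃ d ≤ m, HasCoresolution C X d := by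
  unfold coresolutionDim
  constructor
  · intro h
    have h' := lt_of_le_of_lt h (ENat.natCast_lt_natCast.2 (Nat.lt_succ_self m))
    simp only [iInf_lt_iff] at h'
    obtain ⟨d, hd, hlt⟩ := h'
    exact ⟨d, Nat.lt_succ_iff.1 (ENat.natCast_lt_natCast.1 hlt), hd⟩
  · rintro ⟨d, hd, h⟩
    exact (iInf₂_le d h).trans (by exact_mod_cast hd)

end Coresolutions

/-! ### Indecomposable projective modules and their tops -/

section Idempotents

variable {A : Type u} [Ring A] {n : ℕ} {e : Fin n → A}

theorem IsBasicIdempotentSystem.idem (he : IsBasicIdempotentSystem e) (i : Fin n) :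
    e i * e i = e i := he.complete.idem i

theorem IsBasicIdempotentSystem.smul_smul (he : IsBasicIdempotentSystem e) (i : Fin n) {M : Type*}
    [AddCommGroup M] [Module A M] (x : M) : e i • e i • x = e i • x := by
  rw [← mul_smul, he.idem]

theorem IsBasicIdempotentSystem.exists_smul_ne_zero (he : IsBasicIdempotentSystem e) {M : Type*}
    [AddCommGroup M] [Module A M] {x : M} (hx : x ≠ 0) : ∃ i, e i • x ≠ 0 := by
  by_contra! h
  apply hx
  rw [← one_smul A x, ← he.complete.complete, Finset.sum_smul]
  exact Finset.sum_eq_zero fun i _ => h i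

variable (e) in
/-- The generator `eᵢ` of `P(i) = A eᵢ`. -/
def gen (i : Fin n) : P e i := ⟨e i, Submodule.mem_span_singleton_self _⟩

theorem smul_gen (he : IsBasicIdempotentSystem e) (i : Fin n) (x : P e i) :
    (x : A) • gen e i = x := by
  obtain ⟨x, hx⟩ := x
  obtain ⟨a, rfl⟩ := Submodule.mem_span_singleton.1 hx
  ext
  change a * e i * e i = a * e i
  rw [mul_assoc, he.idem]

theorem idem_smul_gen (he : IsBasicIdempotentSystem e) (i : Fin n) : e i • gen e i = gen e i :=
  Subtype.ext (he.idem i)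

theorem eq_top_of_gen_mem (he : IsBasicIdempotentSystem e) {i : Fin n} {N : Submodule A (P e i)}
    (h : gen e i ∈ N) : N = ⊤ := by
  rw [eq_top_iff]
  intro x _
  rw [← smul_gen he i x]
  exact N.smul_mem _ h

variable (e) in
/-- The map `P(i) → M` given by `x ↦ x m`. It sends the generator to `eᵢ m`. -/
def fromP (i : Fin n) {M : Type*} [AddCommGroup M] [Module A M] (m : M) : P e i →ₗ[A] M :=
  LinearMap.toSpanSingleton A M m ∘ₗ (P e i).subtype

theorem fromP_gen (i : Fin n) {M : Type*} [AddCommGroup M] [Module A M] (m : M) :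
    fromP e i m (gen e i) = e i • m := rfl

theorem projective_P (he : IsBasicIdempotentSystem e) (i : Fin n) :
    Module.Projective A (P e i) := by
  refine Module.Projective.of_split (P e i).subtype
    (LinearMap.toSpanSingleton A (P e i) (gen e i)) ?_
  ext x : 1
  exact smul_gen he i x

instance finite_P (i : Fin n) : Module.Finite A (P e i) :=
  inferInstanceAs (Module.Finite A (Submodule.span A {e i}))

theorem gen_ne_zero (he : IsBasicIdempotentSystem e) (i : Fin n) : gen e i ≠ 0 :=
  fun h => (he.primitive i).2.1 (congrArg Subtype.val h)

theorem nontrivial_P (he : IsBasicIdempotentSystem e) (i : Fin n) : Nontrivial (P e i) :=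
  ⟨_, _, gen_ne_zero he i⟩

/-- `P(i)` is indecomposable, because `eᵢ` is primitive. -/
theorem gen_mem_of_isCompl (he : IsBasicIdempotentSystem e) {i : Fin n}
    {N₁ N₂ : Submodule A (P e i)} (h : IsCompl N₁ N₂) : gen e i ∈ N₁ ∨ gen e i ∈ N₂ := by
  obtain ⟨x, hx, y, hy, hxy⟩ := Submodule.mem_sup.1
    (h.sup_eq_top ▸ Submodule.mem_top : gen e i ∈ N₁ ⊔ N₂)
  have hxy' : (x : A) + y = e i := congrArg Subtype.val hxy
  have dis : ∀ z, z ∈ N₁ → z ∈ N₂ → z = 0 := fun z h₁ h₂ =>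
    (Submodule.mem_bot A).1 (h.inf_eq_bot ▸ ⟨h₁, h₂⟩)
  -- Compare the components of `z eᵢ = z` for `z = x, y`.
  have split : ∀ z : P e i, (z : A) • x + (z : A) • y = z := fun z => by
    rw [← smul_add, hxy, smul_gen he]
  have hx1 : x - (x : A) • x = (x : A) • y := by
    rw [sub_eq_iff_eq_add']; exact (split x).symm
  have hy1 : y - (y : A) • y = (y : A) • x := by
    rw [sub_eq_iff_eq_add]; exact (split y).symm
  have hx2 := dis _ (N₁.sub_mem hx (N₁.smul_mem _ hx)) (hx1 ▸ N₂.smul_mem _ hy)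
  have hy2 := dis _ (hy1 ▸ N₁.smul_mem _ hx) (N₂.sub_mem hy (N₂.smul_mem _ hy))
  have hxx : (x : A) * x = x := congrArg Subtype.val (sub_eq_zero.1 hx2).symm
  have hyy : (y : A) * y = y := congrArg Subtype.val (sub_eq_zero.1 hy2).symm
  have hxy0 : (x : A) * y = 0 := congrArg Subtype.val (hx1.symm.trans hx2)
  have hyx0 : (y : A) * x = 0 := congrArg Subtype.val (hy1.symm.trans hy2)
  rcases (he.primitive i).2.2 x y hxx hyy hxy0 hyx0 hxy' with h0 | h0
  · right
    have : x = 0 := Subtype.ext h0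
    rwa [← hxy, this, zero_add]
  · left
    have : y = 0 := Subtype.ext h0
    rwa [← hxy, this, add_zero]

variable [IsArtinianRing A]

/-- `P(i)` is local: by Fitting's lemma an endomorphism of `P(i)` is nilpotent or surjective. -/
theorem eq_top_or_eq_top_of_sup (he : IsBasicIdempotentSystem e) {i : Fin n}
    {N₁ N₂ : Submodule A (P e i)} (h : N₁ ⊔ N₂ = ⊤) : N₁ = ⊤ ∨ N₂ = ⊤ := by
  obtain ⟨x, hx, y, hy, hxy⟩ := Submodule.mem_sup.1 (h ▸ Submodule.mem_top : gen e i ∈ N₁ ⊔ N₂)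
  let f : Module.End A (P e i) := fromP e i x
  let g : Module.End A (P e i) := fromP e i y
  have hfg : g = 1 - f := by
    rw [eq_sub_iff_add_eq']
    ext z : 1
    change (z : A) • x + (z : A) • y = z
    rw [← smul_add, hxy, smul_gen he]
  obtain ⟨k, hk⟩ := Filter.eventually_atTop.1 f.eventually_isCompl_ker_pow_range_pow
  rcases gen_mem_of_isCompl he (hk (k + 1) (Nat.le_succ k)) with hg | hg
  · right
    have hnil : IsNilpotent f := by
      refine ⟨k + 1, LinearMap.ker_eq_top.1 (eq_top_of_gen_mem he hg)⟩
    have hu : IsUnit g := hfg ▸ hnil.isUnit_one_sub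
    have hs : Function.Surjective g := ((Module.End.isUnit_iff g).1 hu).2
    obtain ⟨z, hz⟩ := hs (gen e i)
    exact eq_top_of_gen_mem he (hz ▸ N₂.smul_mem _ hy)
  · left
    obtain ⟨z, hz⟩ := hg
    rw [pow_succ'] at hz
    exact eq_top_of_gen_mem he (hz ▸ N₁.smul_mem _ hx)

theorem isCoatom_jacobson_P (he : IsBasicIdempotentSystem e) (i : Fin n) :
    IsCoatom (Module.jacobson A (P e i)) ∧
      ∀ N : Submodule A (P e i), N ≠ ⊤ → N ≤ Module.jacobson A (P e i) := by
  have := nontrivial_P he i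
  obtain ⟨m, hm, -⟩ := (eq_top_or_exists_le_coatom (⊥ : Submodule A (P e i))).resolve_left
    bot_ne_top
  have huniq : ∀ m' : Submodule A (P e i), IsCoatom m' → m' = m := fun m' hm' => by
    by_contra hne
    rcases eq_top_or_eq_top_of_sup he (hm'.sup_eq_top_of_ne hm hne) with h | h
    · exact hm'.1 h
    · exact hm.1 h
  have hj : Module.jacobson A (P e i) = m :=
    le_antisymm (sInf_le hm) (le_sInf fun m' hm' => (huniq m' hm').ge)
  rw [hj]
  refine ⟨hm, fun N hN => ?_⟩
  obtain ⟨m', hm', hle⟩ := (eq_top_or_exists_le_coatom N).resolve_left hN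
  exact huniq m' hm' ▸ hle

theorem isSimpleModule_E (he : IsBasicIdempotentSystem e) (i : Fin n) :
    IsSimpleModule A (E e i) :=
  isSimpleModule_iff_isCoatom.2 (isCoatom_jacobson_P he i).1

/-- A simple module not annihilated by `eᵢ` is isomorphic to `E(i)`. -/
theorem nonempty_equiv_E (he : IsBasicIdempotentSystem e) {i : Fin n} {V : Type*} [AddCommGroup V]
    [Module A V] [IsSimpleModule A V] {x : V} (hx : e i • x ≠ 0) :
    Nonempty (V ≃ₗ[A] E e i) := by
  have hne : fromP e i x ≠ 0 := fun h => hx (by rw [← fromP_gen, h]; rfl)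
  have hs : Function.Surjective (fromP e i x) := LinearMap.surjective_of_ne_zero hne
  have hker : IsCoatom (LinearMap.ker (fromP e i x)) := LinearMap.isCoatom_ker_of_surjective hs
  have heq : LinearMap.ker (fromP e i x) = Module.jacobson A (P e i) :=
    (hker.le_iff.1 ((isCoatom_jacobson_P he i).2 _ hker.1)).resolve_left
      (isCoatom_jacobson_P he i).1.1 |>.symm
  obtain ⟨q⟩ := nonempty_quotient_equiv (K := Module.jacobson A (P e i)) (fromP e i x) hs
    fun y => by rw [← heq, LinearMap.mem_ker]
  exact ⟨q.symm⟩

theorem exists_smul_E_ne_zero (he : IsBasicIdempotentSystem e) (i : Fin n) :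
    ∃ x : E e i, e i • x ≠ 0 := by
  refine ⟨Submodule.Quotient.mk (gen e i), ?_⟩
  rw [← Submodule.Quotient.mk_smul, idem_smul_gen he, Ne, Submodule.Quotient.mk_eq_zero]
  exact fun h => (isCoatom_jacobson_P he i).1.1 (eq_top_of_gen_mem he h)

/-- A surjection `P(k) → E(i)` lifts to a surjection `P(k) → P(i)`. -/
theorem exists_surjective_P (he : IsBasicIdempotentSystem e) {i k : Fin n}
    (q : E e k ≃ₗ[A] E e i) : ∃ f : P e k →ₗ[A] P e i, Function.Surjective f := by
  have := projective_P he k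
  obtain ⟨f, hf⟩ := Module.projective_lifting_property (Module.jacobson A (P e i)).mkQ
    (q.toLinearMap ∘ₗ (Module.jacobson A (P e k)).mkQ) (Submodule.mkQ_surjective _)
  refine ⟨f, LinearMap.range_eq_top.1 ?_⟩
  by_contra hne
  have hle := (isCoatom_jacobson_P he i).2 _ hne
  obtain ⟨y, hy⟩ := exists_smul_E_ne_zero he i
  obtain ⟨x, hx⟩ := (q.surjective.comp (Submodule.mkQ_surjective _)) y
  apply hy
  have h0 : y = 0 := ?_
  · rw [h0, smul_zero]
  rw [← hx]
  change (q.toLinearMap ∘ₗ (Module.jacobson A (P e k)).mkQ) x = 0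
  rw [← hf]
  exact (Submodule.Quotient.mk_eq_zero _).2 (hle ⟨x, rfl⟩)

theorem smul_E_eq_zero (he : IsBasicIdempotentSystem e) {i k : Fin n} (hik : k ≠ i) (x : E e i) :
    e k • x = 0 := by
  by_contra hx
  have := isSimpleModule_E he i
  obtain ⟨q⟩ := nonempty_equiv_E he hx
  obtain ⟨f, hf⟩ := exists_surjective_P he q
  obtain ⟨g, hg⟩ := exists_surjective_P he q.symm
  -- `P(i)` and `P(k)` are Noetherian, so the surjections in both directions are bijective.
  have hinj : Function.Injective (g ∘ₗ f) :=
    IsNoetherian.injective_of_surjective_endomorphism (g ∘ₗ f) (hg.comp hf)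
  have hfi : Function.Injective f := Function.Injective.of_comp (f := g) hinj
  exact hik (he.basic i k ⟨LinearEquiv.ofBijective f ⟨hfi, hf⟩⟩).symm

theorem eq_of_smul_ne_zero (he : IsBasicIdempotentSystem e) {i k : Fin n} {V : Type*}
    [AddCommGroup V] [Module A V] (q : V ≃ₗ[A] E e i) {x : V} (hx : e k • x ≠ 0) : k = i := by
  by_contra h
  apply hx
  apply q.injective
  rw [map_smul, smul_E_eq_zero he h, map_zero]

/-- `E(j)` is a composition factor of `M` if and only if `eⱼ M ≠ 0`. -/
theorem isCompositionFactor_iff (he : IsBasicIdempotentSystem e) (j : Fin n) {M : Type u}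
    [AddCommGroup M] [Module A M] :
    IsCompositionFactor (A := A) (E e j) M ↔ ∃ x : M, e j • x ≠ 0 := by
  constructor
  · rintro ⟨N₁, N₂, -, ⟨q⟩⟩
    by_contra! h
    obtain ⟨x, hx⟩ := exists_smul_E_ne_zero he j
    obtain ⟨y, rfl⟩ := q.surjective x
    obtain ⟨z, rfl⟩ := Submodule.mkQ_surjective _ y
    apply hx
    rw [← map_smul, ← map_smul]
    have : e j • z = 0 := Subtype.ext (h z)
    rw [this, map_zero, map_zero]
  · rintro ⟨x, hx⟩
    let f := fromP e j x
    have hne : LinearMap.ker f ≠ ⊤ := fun h =>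
      hx (LinearMap.mem_ker.1 (h ▸ Submodule.mem_top : gen e j ∈ LinearMap.ker f))
    have hle := (isCoatom_jacobson_P he j).2 _ hne
    refine ⟨(Module.jacobson A (P e j)).map f, LinearMap.range f, LinearMap.map_le_range, ?_⟩
    let g : P e j →ₗ[A] ↥(LinearMap.range f) ⧸
        ((Module.jacobson A (P e j)).map f).submoduleOf (LinearMap.range f) :=
      Submodule.mkQ _ ∘ₗ f.rangeRestrict
    obtain ⟨q⟩ := nonempty_quotient_equiv (K := Module.jacobson A (P e j)) g
      ((Submodule.mkQ_surjective _).comp f.surjective_rangeRestrict) fun y => by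
        change Submodule.Quotient.mk _ = _ ↔ _
        rw [Submodule.Quotient.mk_eq_zero]
        change f y ∈ (Module.jacobson A (P e j)).map f ↔ _
        rw [← Submodule.mem_comap, Submodule.comap_map_eq, sup_eq_left.2 hle]
    exact ⟨q.symm⟩

end Idempotents

/-! ### Traces and standard modules -/

section Standard

variable {A : Type u} [Ring A] {n : ℕ} (e : Fin n → A)

/-- The trace of the projective modules `P(j)`, `j > i`, in `M`: the submodule generated by the
elements `eⱼ x`. -/
def trace (i : Fin n) (M : Type*) [AddCommGroup M] [Module A M] : Submodule A M :=
  Submodule.span A {y | ∃ j, i < j ∧ ∃ x : M, e j • x = y}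

variable {e}

theorem trace_le_iff {i : Fin n} {M : Type*} [AddCommGroup M] [Module A M] {N : Submodule A M} :
    trace e i M ≤ N ↔ ∀ j, i < j → ∀ x : M, e j • x ∈ N := by
  rw [trace, Submodule.span_le]
  constructor
  · intro h j hj x
    exact h ⟨j, hj, x, rfl⟩
  · rintro h _ ⟨j, hj, x, rfl⟩
    exact h j hj x

theorem smul_mem_trace {i j : Fin n} (h : i < j) {M : Type*} [AddCommGroup M] [Module A M]
    (x : M) : e j • x ∈ trace e i M :=
  trace_le_iff.1 le_rfl j h x

theorem map_mem_trace {i : Fin n} {M N : Type*} [AddCommGroup M] [Module A M] [AddCommGroup N]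
    [Module A N] (f : M →ₗ[A] N) {x : M} (hx : x ∈ trace e i M) : f x ∈ trace e i N := by
  have : trace e i M ≤ (trace e i N).comap f := trace_le_iff.2 fun j hj x => by
    rw [Submodule.mem_comap, map_smul]
    exact smul_mem_trace hj _
  exact this hx

variable (e) in
/-- The map induced by `f` on the traces. -/
def traceMap (i : Fin n) {M N : Type*} [AddCommGroup M] [Module A M] [AddCommGroup N]
    [Module A N] (f : M →ₗ[A] N) : trace e i M →ₗ[A] trace e i N :=
  f.restrict fun _ hx => map_mem_trace f hx

/-- There are no maps from a trace to a module annihilated by the idempotents `eⱼ`, `j > i`. -/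
theorem hom_trace_eq_zero (he : IsBasicIdempotentSystem e) {i : Fin n} {M Y : Type*}
    [AddCommGroup M] [Module A M] [AddCommGroup Y] [Module A Y]
    (hY : ∀ j, i < j → ∀ y : Y, e j • y = 0) (φ : trace e i M →ₗ[A] Y) : φ = 0 := by
  have h : trace e i M ≤ (LinearMap.ker φ).map (trace e i M).subtype :=
    trace_le_iff.2 fun j hj x => by
      refine ⟨⟨e j • x, smul_mem_trace hj x⟩, ?_, rfl⟩
      have : (⟨e j • x, smul_mem_trace hj x⟩ : trace e i M) =
          e j • ⟨e j • x, smul_mem_trace hj x⟩ := Subtype.ext (he.smul_smul j x).symm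
      rw [SetLike.mem_coe, LinearMap.mem_ker, this, map_smul, hY j hj]
  ext x
  obtain ⟨y, hy, hyx⟩ := h x.2
  obtain rfl : y = x := Subtype.ext hyx
  exact hy

variable (e) in
/-- The canonical surjection `P(i) → Δ(i)`. -/
def toDelta (i : Fin n) : P e i →ₗ[A] Delta e i := Submodule.mkQ _

theorem toDelta_surjective (i : Fin n) : Function.Surjective (toDelta e i) :=
  Submodule.mkQ_surjective _

variable [IsArtinianRing A]

theorem sInf_eq_trace (he : IsBasicIdempotentSystem e) (i : Fin n) :
    sInf {N : Submodule A ↥(P e i) | ∀ j, i < j →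
      ¬ IsCompositionFactor (A := A) (E e j) (↥(P e i) ⧸ N)} = trace e i (P e i) := by
  have hiff : ∀ N : Submodule A (P e i), (∀ j, i < j →
      ¬ IsCompositionFactor (A := A) (E e j) (↥(P e i) ⧸ N)) ↔ trace e i (P e i) ≤ N := by
    intro N
    simp only [isCompositionFactor_iff he, not_exists, not_not, trace_le_iff]
    refine forall₂_congr fun j _ => ?_
    rw [(Submodule.mkQ_surjective N).forall]
    refine forall_congr' fun x => ?_
    rw [← map_smul, Submodule.mkQ_apply, Submodule.Quotient.mk_eq_zero]
  simp only [hiff]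
  exact le_antisymm (sInf_le (le_refl (trace e i (P e i)))) (le_sInf fun _ h => h)

theorem toDelta_eq_zero_iff (he : IsBasicIdempotentSystem e) (i : Fin n) (x : P e i) :
    toDelta e i x = 0 ↔ x ∈ trace e i (P e i) := by
  rw [← sInf_eq_trace he]
  exact Submodule.Quotient.mk_eq_zero _

theorem exact_toDelta (he : IsBasicIdempotentSystem e) (i : Fin n) :
    Function.Exact (trace e i (P e i)).subtype (toDelta e i) := fun x => by
  rw [toDelta_eq_zero_iff he]
  simp

instance finite_Delta (i : Fin n) : Module.Finite A (Delta e i) :=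
  Module.Finite.of_surjective _ (toDelta_surjective i)

theorem smul_Delta_eq_zero (he : IsBasicIdempotentSystem e) {i j : Fin n} (hij : i < j)
    (x : Delta e i) : e j • x = 0 := by
  obtain ⟨y, rfl⟩ := toDelta_surjective i x
  rw [← map_smul, toDelta_eq_zero_iff he]
  exact smul_mem_trace hij y

theorem extVanishes_one_Delta (he : IsBasicIdempotentSystem e) {i : Fin n} {Y : Type u}
    [AddCommGroup Y] [Module A Y]
    (h : ∀ φ : trace e i (P e i) →ₗ[A] Y, ∃ ψ : P e i →ₗ[A] Y,
      ψ ∘ₗ (trace e i (P e i)).subtype = φ) : ExtVanishes A 1 (Delta e i) Y := by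
  have := projective_P he i
  exact ExtVanishes.one_of_extension (Submodule.injective_subtype _) (exact_toDelta he i)
    (toDelta_surjective i) h

theorem extVanishes_one_Delta_of_smul (he : IsBasicIdempotentSystem e) {i : Fin n} {Y : Type u}
    [AddCommGroup Y] [Module A Y] (hY : ∀ j, i < j → ∀ y : Y, e j • y = 0) :
    ExtVanishes A 1 (Delta e i) Y :=
  extVanishes_one_Delta he fun φ => ⟨0, by rw [hom_trace_eq_zero he hY φ, LinearMap.zero_comp]⟩

/-- The trace of `P(j)`, `j > i`, in a module with a `Δ`-filtration is filtered by the `Δ(k)` with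
`k > i`: a factor `Δ(k)` with `k ≤ i` does not contribute to the trace, while a factor `Δ(k)` with
`k > i` can be moved into it, because the kernel of `P(k) → Δ(k)` is a trace itself. -/
theorem HasFiltration.trace (he : IsBasicIdempotentSystem e) (i : Fin n) {M : Type u}
    [AddCommGroup M] [Module A M] (hM : HasFiltration (IsStandard e) (ModuleCat.of A M)) :
    HasFiltration (fun X : ModuleCat.{u} A => ∃ k, i < k ∧ Nonempty (X ≃ₗ[A] Delta e k))
      (ModuleCat.of A (trace e i M)) := by
  refine HasFiltration.induction (p := fun M => HasFiltration
    (fun X : ModuleCat.{u} A => ∃ k, i < k ∧ Nonempty (X ≃ₗ[A] Delta e k))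
      (ModuleCat.of A (StdStrat.trace e i M))) ?_ ?_ hM
  · intro M _
    exact HasFiltration.of_subsingleton _
  intro L M N f g hf hfg hg hMfin hL ⟨k, ⟨q⟩⟩
  -- An element `eⱼ x` in the kernel of `g` comes from `eⱼ L`.
  have lift : ∀ j, i < j → ∀ x : M, g (e j • x) = 0 →
      ∃ l ∈ StdStrat.trace e i L, f l = e j • x := by
    intro j hj x hx
    obtain ⟨l, hl⟩ := (hfg _).1 hx
    refine ⟨e j • l, smul_mem_trace hj l, ?_⟩
    rw [map_smul, hl, he.smul_smul]
  have hinj : Function.Injective (traceMap e i f) := fun a b h =>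
    Subtype.ext (hf (congrArg Subtype.val h))
  by_cases hk : i < k
  · have := projective_P he k
    obtain ⟨p, hp⟩ := Module.projective_lifting_property g
      (q.symm.toLinearMap ∘ₗ toDelta e k) hg
    have hp' : ∀ y, g (p y) = q.symm (toDelta e k y) := fun y => LinearMap.congr_fun hp y
    have hspan : StdStrat.trace e i M ≤
        LinearMap.range p ⊔ (StdStrat.trace e i L).map f := by
      refine trace_le_iff.2 fun j hj x => ?_
      obtain ⟨y, hy⟩ := toDelta_surjective k (q (g x))
      obtain ⟨l, hl, hl'⟩ := lift j hj (x - p y) (by simp [hp', hy])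
      rw [show e j • x = p (e j • y) + e j • (x - p y) by
        rw [map_smul, ← smul_add, add_sub_cancel], ← hl']
      exact Submodule.add_mem_sup ⟨_, rfl⟩ ⟨l, hl, rfl⟩
    have hker : StdStrat.trace e k (P e k) ≤ ((StdStrat.trace e i L).map f).comap p := by
      refine trace_le_iff.2 fun j hj y => ?_
      obtain ⟨l, hl, hl'⟩ := lift j (hk.trans hj) (p y) (by
        rw [← map_smul, hp', (toDelta_eq_zero_iff he k _).2 (smul_mem_trace hj y), map_zero])
      exact ⟨l, hl, by rw [hl', map_smul]⟩
    refine HasFiltration.step (f := traceMap e i f)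
      (g := g ∘ₗ (StdStrat.trace e i M).subtype) hinj (fun x => ?_) (fun y => ?_) hL
      ⟨k, hk, ⟨q⟩⟩ inferInstance
    · constructor
      · intro hx
        obtain ⟨_, ⟨y, rfl⟩, _, ⟨l, hl, rfl⟩, hsum⟩ := Submodule.mem_sup.1 (hspan x.2)
        have hgx : g x = 0 := hx
        rw [← hsum, map_add, hfg.apply_apply_eq_zero, add_zero, hp',
          LinearEquiv.map_eq_zero_iff, toDelta_eq_zero_iff he] at hgx
        obtain ⟨l', hl', e'⟩ := hker hgx
        refine ⟨⟨l' + l, add_mem hl' hl⟩, Subtype.ext ?_⟩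
        change f (l' + l) = x
        rw [map_add, e', hsum]
      · rintro ⟨l, rfl⟩
        exact hfg.apply_apply_eq_zero l.1
    · obtain ⟨z, hz⟩ := toDelta_surjective k (q y)
      refine ⟨⟨p z, ?_⟩, ?_⟩
      · rw [← smul_gen he k z, map_smul, ← idem_smul_gen he, map_smul]
        exact Submodule.smul_mem _ _ (smul_mem_trace hk _)
      · change g (p z) = y
        rw [hp', hz, LinearEquiv.symm_apply_apply]
  · refine hL.congr (LinearEquiv.ofBijective (traceMap e i f) ⟨hinj, ?_⟩)
    have hle : StdStrat.trace e i M ≤ (StdStrat.trace e i L).map f :=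
      trace_le_iff.2 fun j hj x => lift j hj x (by
        apply q.injective
        rw [map_smul, map_smul, smul_Delta_eq_zero he ((not_lt.1 hk).trans_lt hj), map_zero])
    intro x
    obtain ⟨l, hl, e'⟩ := hle x.2
    exact ⟨⟨l, hl⟩, Subtype.ext e'⟩

end Standard

/-! ### Injective envelopes -/

section InjectiveEnvelope

variable {A : Type u} [Ring A]

/-- Every module has an injective envelope: a maximal essential extension inside an injective
module is a direct summand of it. -/
theorem exists_isInjectiveEnvelope (S : Type u) [AddCommGroup S] [Module A S] :
    ∃ Q : ModuleCat.{u} A, IsInjectiveEnvelope (A := A) S Q := by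
  obtain ⟨⟨I, hI, f, hf⟩⟩ := EnoughInjectives.presentation (ModuleCat.of A S)
  have hI' : Module.Injective A I := Module.injective_module_of_injective_object A I
  replace hf : Function.Injective f.hom := (ModuleCat.mono_iff_injective f).1 hf
  generalize f.hom = f at hf
  change S →ₗ[A] I at f
  let S' : Submodule A I := LinearMap.range f
  have mem_chain : ∀ {c : Set (Submodule A I)}, IsChain (· ≤ ·) c → c.Nonempty → ∀ {x},
      x ∈ sSup c → ∃ N ∈ c, x ∈ N := fun hc hne x hx =>
    (Submodule.mem_sSup_of_directed hne hc.directedOn).1 hx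
  -- A maximal essential extension `Q` of `S'` in `I`.
  obtain ⟨Q, -, ⟨hSQ, hQ⟩, hQmax⟩ := zorn_le_nonempty₀
    {N : Submodule A I | S' ≤ N ∧ ∀ K ≤ N, K ⊓ S' = ⊥ → K = ⊥}
    (fun c hc hchain N hN => ⟨sSup c, ⟨(hc hN).1.trans (le_sSup hN), fun K hK hKS => by
      rw [Submodule.eq_bot_iff]
      intro x hx
      obtain ⟨N', hN', hxN'⟩ := mem_chain hchain ⟨N, hN⟩ (hK hx)
      have hle : Submodule.span A {x} ≤ K := (Submodule.span_singleton_le_iff_mem _ _).2 hx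
      have := (hc hN').2 (Submodule.span A {x})
        ((Submodule.span_singleton_le_iff_mem _ _).2 hxN')
        (le_bot_iff.1 ((inf_le_inf_right _ hle).trans hKS.le))
      exact Submodule.span_singleton_eq_bot.1 this⟩, fun z hz => le_sSup hz⟩)
    S' ⟨le_rfl, fun K hK h => by rwa [inf_eq_left.2 hK] at h⟩
  -- A submodule `C` maximal with `C ⊓ S' = ⊥`; then `S'` is essential in `I ⧸ C`.
  obtain ⟨C, -, hC, hCmax⟩ := zorn_le_nonempty₀ {C : Submodule A I | C ⊓ S' = ⊥}
    (fun c hc hchain N hN => ⟨sSup c, by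
      change sSup c ⊓ S' = ⊥
      rw [Submodule.eq_bot_iff]
      rintro x ⟨hx, hxS⟩
      obtain ⟨N', hN', hxN'⟩ := mem_chain hchain ⟨N, hN⟩ hx
      exact (Submodule.mem_bot A).1 ((hc hN' : N' ⊓ S' = ⊥) ▸ ⟨hxN', hxS⟩),
      fun z hz => le_sSup hz⟩) ⊥ (bot_inf_eq S')
  have hess : ∀ K : Submodule A (I ⧸ C), (∀ x ∈ S', C.mkQ x ∈ K → x = 0) → K = ⊥ := by
    intro K hK
    have h1 : K.comap C.mkQ ≤ C := hCmax
      (by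
        change K.comap C.mkQ ⊓ S' = ⊥
        rw [Submodule.eq_bot_iff]
        rintro x ⟨hx, hxS⟩
        exact hK x hxS hx) (Submodule.le_comap_mkQ C K)
    rw [Submodule.eq_bot_iff]
    intro y hy
    obtain ⟨x, rfl⟩ := C.mkQ_surjective y
    exact (Submodule.Quotient.mk_eq_zero C).2 (h1 hy)
  have hQC : Q ⊓ C = ⊥ := hQ _ inf_le_left
    (le_bot_iff.1 ((inf_le_inf_right _ inf_le_right).trans (le_of_eq hC)))
  obtain ⟨h, hh⟩ := hI'.out (C.mkQ ∘ₗ Q.subtype) (by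
    rw [← LinearMap.ker_eq_bot, Submodule.eq_bot_iff]
    intro x hx
    have hxC : (x : I) ∈ C := (Submodule.Quotient.mk_eq_zero C).1 hx
    exact Subtype.ext ((Submodule.mem_bot A).1 (hQC ▸ ⟨x.2, hxC⟩))) Q.subtype
  have hh' : ∀ x ∈ Q, h (C.mkQ x) = x := fun x hx => hh ⟨x, hx⟩
  have hrange : LinearMap.range h ≤ Q := by
    refine hQmax ⟨fun x hx => ⟨_, hh' x (hSQ hx)⟩, fun K hK hKS => ?_⟩ fun x hx => ⟨_, hh' x hx⟩
    have h2 : K.comap h = ⊥ := hess _ fun x hx hxK => by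
      rw [Submodule.mem_comap, hh' x (hSQ hx)] at hxK
      exact (Submodule.mem_bot A).1 (hKS ▸ ⟨hxK, hx⟩)
    rw [Submodule.eq_bot_iff]
    intro x hx
    obtain ⟨y, rfl⟩ := hK hx
    have : y ∈ K.comap h := hx
    rw [h2, Submodule.mem_bot] at this
    rw [this, map_zero]
  refine ⟨ModuleCat.of A Q, ⟨fun X Y _ _ _ _ i hi g => ?_⟩,
    LinearMap.codRestrict Q f fun x => hSQ ⟨x, rfl⟩,
    fun a b hab => hf (congrArg Subtype.val hab), fun N hN => ?_⟩
  · obtain ⟨k, hk⟩ := hI'.out i hi (Q.subtype ∘ₗ g)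
    refine ⟨LinearMap.codRestrict Q (h ∘ₗ C.mkQ ∘ₗ k) fun y => hrange ⟨_, rfl⟩, fun x => ?_⟩
    apply Subtype.ext
    change h (C.mkQ (k (i x))) = g x
    rw [hk]
    exact hh' _ (g x).2
  · change Submodule A Q at N
    have h3 : N.map Q.subtype = ⊥ := by
      refine hQ _ (Submodule.map_subtype_le _ _) ?_
      rw [Submodule.eq_bot_iff]
      rintro _ ⟨⟨x, hx, rfl⟩, y, hy⟩
      have hx0 : x = 0 := by
        refine (Submodule.mem_bot A).1 ?_
        rw [← hN]
        exact ⟨hx, y, Subtype.ext hy⟩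
      rw [hx0, map_zero]
    rw [Submodule.eq_bot_iff]
    intro x hx
    have hx' : (x : I) ∈ N.map Q.subtype := ⟨x, hx, rfl⟩
    rw [h3, Submodule.mem_bot] at hx'
    exact Subtype.ext hx'

end InjectiveEnvelope

/-! ### Proper costandard modules -/

section Costandard

variable {A : Type u} [Ring A] [IsArtinianRing A] {n : ℕ} {e : Fin n → A}

/-- If the module `N` contains `E(j)` as a submodule `S`, multiplicity one of `E(j)` in `N` forces
`eⱼ N ⊆ S`. -/
theorem smul_mem_of_hasMultiplicity_one (he : IsBasicIdempotentSystem e) {j : Fin n} {N : Type u}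
    [AddCommGroup N] [Module A N] {S : Submodule A N} (q : S ≃ₗ[A] E e j)
    (h : HasMultiplicity (A := A) (E e j) N 1) (x : N) : e j • x ∈ S := by
  obtain ⟨s, hhead, hlast, hcard⟩ := h
  obtain ⟨i₀, hi₀⟩ := Set.ncard_eq_one.1 hcard
  have := isSimpleModule_E he j
  have hSs : IsSimpleModule A S := IsSimpleModule.congr q
  have hsimple : ∀ i : Fin s.length,
      IsSimpleModule A (↥(s i.succ) ⧸ (s i.castSucc).submoduleOf (s i.succ)) := fun i =>
    (covBy_iff_quot_is_simple (s.step i).le).1 (s.step i)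
  have hmem : ∀ i : Fin s.length, Nonempty
      ((↥(s i.succ) ⧸ (s i.castSucc).submoduleOf (s i.succ)) ≃ₗ[A] E e j) → i = i₀ := fun i hi => by
    have : i ∈ ({i₀} : Set (Fin s.length)) := hi₀ ▸ hi
    exact this
  -- Outside of `i₀` multiplication by `eⱼ` goes down one step.
  have hdown : ∀ i : Fin s.length, i ≠ i₀ → ∀ y ∈ s i.succ, e j • y ∈ s i.castSucc := by
    intro i hi y hy
    by_contra hcon
    refine hi (hmem i ?_)
    have := hsimple i
    refine nonempty_equiv_E he (x := Submodule.Quotient.mk ⟨y, hy⟩) ?_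
    rw [← Submodule.Quotient.mk_smul, Ne, Submodule.Quotient.mk_eq_zero]
    exact hcon
  -- The submodule `S` appears in step `i₀`.
  obtain ⟨i₁, hi₁, hi₁'⟩ : ∃ i : Fin s.length, ¬ S ≤ s i.castSucc ∧ S ≤ s i.succ := by
    by_contra! hcon
    have key : ∀ k, ¬ S ≤ s k := by
      refine Fin.induction ?_ fun i hi => hcon i hi
      intro hle
      have h0 : S ≤ ⊥ := hle.trans_eq hhead
      have := hSs.nontrivial
      exact (Submodule.nontrivial_iff_ne_bot.1 this) (le_bot_iff.1 h0)
    exact key (Fin.last _) (le_top.trans_eq hlast.symm)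
  have hi₁₀ : i₁ = i₀ := by
    apply hmem
    have := hsimple i₁
    let g : S →ₗ[A] ↥(s i₁.succ) ⧸ (s i₁.castSucc).submoduleOf (s i₁.succ) :=
      Submodule.mkQ _ ∘ₗ Submodule.inclusion hi₁'
    have hg : g ≠ 0 := fun h0 => hi₁ fun y hy => by
      have hgy : g ⟨y, hy⟩ = 0 := by rw [h0]; rfl
      have : Submodule.inclusion hi₁' ⟨y, hy⟩ ∈ (s i₁.castSucc).submoduleOf (s i₁.succ) :=
        (Submodule.Quotient.mk_eq_zero _).1 hgy
      exact this
    exact ⟨(LinearEquiv.ofBijective g (LinearMap.bijective_of_ne_zero hg)).symm.trans q⟩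
  subst hi₁₀
  have hbelow : ∀ k : Fin (s.length + 1), k ≤ i₁.castSucc → ∀ y ∈ s k, e j • y = 0 := by
    refine Fin.induction ?_ ?_
    · intro _ y hy
      have : y ∈ (⊥ : Submodule A N) := hhead ▸ hy
      rw [(Submodule.mem_bot A).1 this, smul_zero]
    · intro i ih hi y hy
      have hlt : i < i₁ := Fin.succ_le_castSucc_iff.1 hi
      rw [← he.smul_smul]
      exact ih (Fin.castSucc_le_castSucc_iff.2 hlt.le) _ (hdown i hlt.ne y hy)
  have habove : ∀ k : Fin (s.length + 1), i₁.succ ≤ k → ∀ y ∈ s k, e j • y ∈ s i₁.succ := by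
    refine Fin.induction ?_ ?_
    · intro h0
      exact absurd h0 (by simp)
    · intro i ih hi y hy
      rcases eq_or_ne i i₁ with rfl | hne
      · exact Submodule.smul_mem _ _ hy
      · rw [← he.smul_smul]
        have hlt : i₁ < i := lt_of_le_of_ne (Fin.succ_le_succ_iff.1 hi) hne.symm
        exact ih (Fin.succ_le_castSucc_iff.2 hlt) _ (hdown i hne y hy)
  have hx := habove (Fin.last _) (Fin.le_last _) x (by
    have : x ∈ s.last := hlast ▸ Submodule.mem_top
    exact this)
  have hsup : S ⊔ s i₁.castSucc = s i₁.succ := by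
    refine ((s.step i₁).wcovBy.eq_or_eq le_sup_right
      (sup_le hi₁' (s.step i₁).le)).resolve_left fun h => hi₁ ?_
    exact h ▸ le_sup_left
  obtain ⟨a, ha, b, hb, hab⟩ := Submodule.mem_sup.1 (hsup ▸ hx)
  rw [← he.smul_smul, ← hab, smul_add, hbelow _ le_rfl b hb, add_zero]
  exact S.smul_mem _ ha

/-- If the finitely generated module `N` contains `E(j)` as a submodule `S` with `eⱼ N ⊆ S`, then
`E(j)` has multiplicity one in `N`. -/
theorem hasMultiplicity_one_of_smul_mem (he : IsBasicIdempotentSystem e) {j : Fin n} {N : Type u}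
    [AddCommGroup N] [Module A N] [Module.Finite A N] {S : Submodule A N} (q : S ≃ₗ[A] E e j)
    (h : ∀ x : N, e j • x ∈ S) : HasMultiplicity (A := A) (E e j) N 1 := by
  have := isSimpleModule_E he j
  have hSs : IsSimpleModule A S := IsSimpleModule.congr q
  obtain ⟨t, hhead, hlast⟩ := exists_compositionSeries_of_isNoetherian_isArtinian A (N ⧸ S)
  let s : CompositionSeries (Submodule A N) :=
    { length := t.length + 1
      toFun := Fin.cons ⊥ fun i => (t i).comap S.mkQ
      step := by
        refine Fin.cases ?_ ?_
        · change ⊥ ⋖ (t 0).comap S.mkQ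
          rw [show t 0 = ⊥ from hhead, ← LinearMap.ker, Submodule.ker_mkQ, bot_covBy_iff]
          exact isSimpleModule_iff_isAtom.1 hSs
        · intro i
          exact Submodule.comap_covBy_of_surjective S.mkQ_surjective (t.step i) }
  have hs0 : s 0 = ⊥ := rfl
  have hs : ∀ i, s (Fin.succ i) = (t i).comap S.mkQ := fun i => rfl
  have hs1 : s (Fin.succ 0) = S := by
    rw [hs, show t 0 = ⊥ from hhead, ← LinearMap.ker, Submodule.ker_mkQ]
  have hSle : ∀ i, S ≤ s (Fin.succ i) := fun i => Submodule.le_comap_mkQ S _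
  refine ⟨s, hs0, ?_, ?_⟩
  · change (t (Fin.last _)).comap S.mkQ = ⊤
    rw [show t (Fin.last _) = ⊤ from hlast, Submodule.comap_top]
  rw [Set.ncard_eq_one]
  refine ⟨(0 : Fin (t.length + 1)), Set.eq_singleton_iff_unique_mem.2 ⟨?_, ?_⟩⟩
  · obtain ⟨q'⟩ := nonempty_quotient_equiv (K := (⊥ : Submodule A N).submoduleOf S) q.toLinearMap
      q.surjective fun x => by
        rw [LinearEquiv.coe_coe, LinearEquiv.map_eq_zero_iff]
        exact Subtype.ext_iff
    change Nonempty ((↥(s (Fin.succ 0)) ⧸ (s 0).submoduleOf (s (Fin.succ 0))) ≃ₗ[A] E e j)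
    rw [hs1]
    exact ⟨q'⟩
  · refine Fin.cases (fun _ => rfl) ?_
    rintro i ⟨r⟩
    exfalso
    obtain ⟨x, hx⟩ := exists_smul_E_ne_zero he j
    obtain ⟨y, rfl⟩ := r.surjective x
    obtain ⟨z, rfl⟩ := Submodule.mkQ_surjective _ y
    apply hx
    rw [← map_smul, ← map_smul]
    have : e j • z ∈ (s (Fin.succ i).castSucc).submoduleOf (s (Fin.succ i).succ) :=
      hSle i.castSucc (h z)
    rw [Submodule.mkQ_apply, (Submodule.Quotient.mk_eq_zero _).2 this, map_zero]

theorem mem_nabla_iff (he : IsBasicIdempotentSystem e) (j : Fin n) {Q : Type u} [AddCommGroup Q]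
    [Module A Q] {x : Q} : x ∈ nabla e j Q ↔ ∀ k, j < k → ∀ a : A, e k • a • x = 0 := by
  let B : Submodule A Q :=
    { carrier := {x | ∀ k, j < k → ∀ a : A, e k • a • x = 0}
      add_mem' := fun hx hy k hk a => by rw [smul_add, smul_add, hx k hk a, hy k hk a, add_zero]
      zero_mem' := fun k _ a => by rw [smul_zero, smul_zero]
      smul_mem' := fun b x hx k hk a => by rw [smul_smul a b]; exact hx k hk (a * b) }
  have hB : nabla e j Q = B := by
    simp only [nabla, isCompositionFactor_iff he, not_exists, not_not]
    refine le_antisymm (sSup_le fun N hN x hx k hk a => ?_) (le_sSup fun k hk x => ?_)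
    · exact congrArg Subtype.val (hN k hk ⟨a • x, N.smul_mem a hx⟩)
    · apply Subtype.ext
      simpa using x.2 k hk 1
  rw [hB]
  rfl

/-- In an essential extension `Q` of `S ≅ E(j)`, the proper costandard module consists of the `x`
such that `E(k)`, `k > j`, is not a composition factor of `A x`, and `E(j)` is not a composition
factor of `(A x + S) / S`. -/
theorem mem_nablaBar_iff (he : IsBasicIdempotentSystem e) {j : Fin n} {Q : Type u} [AddCommGroup Q]
    [Module A Q] {S : Submodule A Q} (q : S ≃ₗ[A] E e j)
    (hS : ∀ N : Submodule A Q, N ⊓ S = ⊥ → N = ⊥) {x : Q} :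
    x ∈ nablaBar e j Q ↔
      (∀ k, j < k → ∀ a : A, e k • a • x = 0) ∧ ∀ a : A, e j • a • x ∈ S := by
  have hEs := isSimpleModule_E he j
  have hSs : IsSimpleModule A S := IsSimpleModule.congr q
  have hatom : IsAtom S := isSimpleModule_iff_isAtom.1 hSs
  have hSk : ∀ k, j < k → ∀ y ∈ S, e k • y = 0 := fun k hk y hy => by
    have : e k • (⟨y, hy⟩ : S) = 0 := by
      by_contra h
      exact hk.ne' (eq_of_smul_ne_zero he q h)
    exact congrArg Subtype.val this
  constructor
  · let B : Submodule A Q :=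
      { carrier := {x | ∀ a : A, e j • a • x ∈ S}
        add_mem' := fun hx hy a => by
          rw [smul_add, smul_add]; exact S.add_mem (hx a) (hy a)
        zero_mem' := fun a => by rw [smul_zero, smul_zero]; exact S.zero_mem
        smul_mem' := fun b x hx a => by rw [smul_smul a b]; exact hx (a * b) }
    have hle : nablaBar e j Q ≤ nabla e j Q ⊓ B := by
      refine sSup_le fun N hN => le_inf hN.1 fun y hy a => ?_
      by_cases hSN : S ≤ N
      · have := smul_mem_of_hasMultiplicity_one he (S := S.submoduleOf N)
          ((Submodule.submoduleOfEquivOfLe hSN).trans q) hN.2 ⟨a • y, N.smul_mem a hy⟩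
        exact this
      · have hbot : N = ⊥ := hS N ((hatom.le_iff.1 inf_le_right).resolve_right
          fun h => hSN (h ▸ inf_le_left))
        rw [hbot, Submodule.mem_bot] at hy
        rw [hy, smul_zero, smul_zero]
        exact S.zero_mem
    intro hx
    exact ⟨(mem_nabla_iff he j).1 (hle hx).1, (hle hx).2⟩
  · rintro ⟨h₁, h₂⟩
    let N : Submodule A Q := S ⊔ Submodule.span A {x}
    have hSN : S ≤ N := le_sup_left
    have hfin : Module.Finite A N := by
      have : Module.Finite A S := Module.Finite.equiv q.symm
      exact inferInstance
    have hN : N ≤ nabla e j Q := by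
      refine sup_le (fun y hy => (mem_nabla_iff he j).2 fun k hk a => hSk k hk _ (S.smul_mem a hy))
        ((Submodule.span_singleton_le_iff_mem _ _).2 ((mem_nabla_iff he j).2 h₁))
    refine (le_sSup ⟨hN, ?_⟩ : N ≤ nablaBar e j Q)
      (Submodule.mem_sup_right (Submodule.mem_span_singleton_self x))
    refine hasMultiplicity_one_of_smul_mem he (S := S.submoduleOf N)
      ((Submodule.submoduleOfEquivOfLe hSN).trans q) ?_
    rintro ⟨y, hy⟩
    obtain ⟨z, hz, w, hw, rfl⟩ := Submodule.mem_sup.1 hy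
    obtain ⟨a, rfl⟩ := Submodule.mem_span_singleton.1 hw
    change e j • (z + a • x) ∈ S
    rw [smul_add]
    exact S.add_mem (S.smul_mem _ hz) (h₂ a)

/-- `Ext¹(Δ(i), ∇̄(j)) = 0`. -/
theorem extVanishes_one_of_isProperCostandard (he : IsBasicIdempotentSystem e) {X : ModuleCat.{u} A}
    (hX : IsProperCostandard e X) (i : Fin n) : ExtVanishes A 1 (Delta e i) X := by
  obtain ⟨j, Q, ⟨hQ, f, hf, hess⟩, ⟨r⟩⟩ := hX
  have hmem := fun x => mem_nablaBar_iff he (LinearEquiv.ofInjective f hf).symm hess (x := x)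
  refine ExtVanishes.congr_right ?_ r.symm
  rcases le_or_gt j i with hji | hij
  · refine extVanishes_one_Delta_of_smul he fun k hk y => Subtype.ext ?_
    simpa using ((hmem y).1 y.2).1 k (hji.trans_lt hk) 1
  · refine ExtVanishes.covariant_left (nablaBar e j Q).injective_subtype
      (g := (nablaBar e j Q).mkQ) (fun x => by simp) (Submodule.mkQ_surjective _)
      (ExtVanishes.zero_iff.2 fun φ => ?_) (ExtVanishes.of_injective hQ 0)
    refine LinearMap.ext fun y => ?_
    obtain ⟨x, hx⟩ := (nablaBar e j Q).mkQ_surjective (φ y)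
    -- `e k a x` lies in `∇̄(j)` for `k ≥ j`, because `Δ(i)` has no composition factors `E(k)`.
    have hk : ∀ k, j ≤ k → ∀ a : A, e k • a • x ∈ nablaBar e j Q := fun k hk a => by
      rw [← Submodule.Quotient.mk_eq_zero, ← Submodule.mkQ_apply, map_smul, map_smul, hx,
        ← map_smul, ← map_smul, smul_Delta_eq_zero he (hij.trans_le hk), map_zero]
    rw [← hx, LinearMap.zero_apply, Submodule.mkQ_apply, Submodule.Quotient.mk_eq_zero, hmem]
    constructor
    · intro k hjk a
      have := ((hmem _).1 (hk k hjk.le a)).1 k hjk 1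
      rwa [one_smul, he.smul_smul] at this
    · intro a
      have := ((hmem _).1 (hk j le_rfl a)).2 1
      rwa [one_smul, he.smul_smul] at this

end Costandard

/-! ### Modules without extensions by standard modules -/

section Good

variable {A : Type u} [Ring A] [IsArtinianRing A] {n : ℕ} {e : Fin n → A}

/-- Dimension shifting: the kernel of `P(i) → Δ(i)` is a direct summand of the trace of the `P(j)`,
`j > i`, in `A`, which is filtered by standard modules `Δ(j)`, `j > i`. -/
theorem extVanishes_Delta_succ (he : IsBasicIdempotentSystem e) (hA : IsStandardlyStratified e)
    {i : Fin n} {k : ℕ} {Y : Type u} [AddCommGroup Y] [Module A Y]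
    (h : ∀ j, i < j → ExtVanishes A k (Delta e j) Y) : ExtVanishes A (k + 1) (Delta e i) Y := by
  have := projective_P he i
  have htr : ExtVanishes A k (trace e i A) Y := by
    refine (HasFiltration.trace he i hA).extVanishes_left ?_
    rintro X ⟨j, hij, ⟨q⟩⟩
    exact (h j hij).congr_left q
  have hK : ExtVanishes A k (trace e i (P e i)) Y := by
    refine htr.retract_left (traceMap e i (P e i).subtype)
      (traceMap e i (LinearMap.toSpanSingleton A (P e i) (gen e i))) ?_
    ext x : 2
    exact smul_gen he i x
  exact ExtVanishes.contravariant_right (Submodule.injective_subtype _) (exact_toDelta he i)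
    (toDelta_surjective i) hK (ExtVanishes.of_projective k)

variable (e) in
/-- The `Δ`-injective modules: the modules `Y` with `Ext¹(Δ(i), Y) = 0` for all `i`. -/
def IsDeltaInjective (Y : Type u) [AddCommGroup Y] [Module A Y] : Prop :=
  ∀ i, ExtVanishes A 1 (Delta e i) Y

theorem IsDeltaInjective.extVanishes (he : IsBasicIdempotentSystem e)
    (hA : IsStandardlyStratified e) {Y : Type u} [AddCommGroup Y] [Module A Y]
    (h : IsDeltaInjective e Y) (k : ℕ) : ∀ i, ExtVanishes A (k + 1) (Delta e i) Y := by
  induction k with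
  | zero => exact h
  | succ k ih => exact fun i => extVanishes_Delta_succ he hA fun j _ => ih j

/-- `Ext^m(Δ(i), -) = 0` for `m ≥ n - i`: the indices are those of `Fin n`, so `Δ(n - 1)` is
projective. -/
theorem extVanishes_Delta_of_le (he : IsBasicIdempotentSystem e) (hA : IsStandardlyStratified e)
    {Y : Type u} [AddCommGroup Y] [Module A Y] (m : ℕ) :
    ∀ i : Fin n, n ≤ i + m → ExtVanishes A m (Delta e i) Y := by
  induction m with
  | zero => intro i hi; omega
  | succ m ih => exact fun i hi => extVanishes_Delta_succ he hA fun j hj => ih j (by omega)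

theorem HasFiltration.extVanishes_of_Delta {X Y : Type u} [AddCommGroup X] [Module A X]
    [AddCommGroup Y] [Module A Y] {k : ℕ} (hX : HasFiltration (IsStandard e) (ModuleCat.of A X))
    (h : ∀ i, ExtVanishes A k (Delta e i) Y) : ExtVanishes A k X Y :=
  hX.extVanishes_left fun _ ⟨i, ⟨q⟩⟩ => (h i).congr_left q

theorem HasFiltration.isDeltaInjective (he : IsBasicIdempotentSystem e) {Y : Type u}
    [AddCommGroup Y] [Module A Y]
    (hY : HasFiltration (IsProperCostandard e) (ModuleCat.of A Y)) : IsDeltaInjective e Y :=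
  fun i => hY.extVanishes_right fun _ hX => extVanishes_one_of_isProperCostandard he hX i

theorem exists_simple_le {Y : Type u} [AddCommGroup Y] [Module A Y] [Module.Finite A Y]
    {N : Submodule A Y} (hN : N ≠ ⊥) : ∃ S ≤ N, IsSimpleModule A S := by
  obtain ⟨S, hS, hle⟩ := (eq_bot_or_exists_atom_le N).resolve_left hN
  exact ⟨S, hle, isSimpleModule_iff_isAtom.2 hS⟩

/-- If `E(k)` is not a composition factor of the socle of `Y` for `k < j` and `Y` is
`Δ`-injective, then `Ext¹(E(k), Y) = 0` for `k < j`: there is no map from the radical of `Δ(k)` to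
`Y`. -/
theorem extVanishes_one_of_isSimpleModule (he : IsBasicIdempotentSystem e) {j : Fin n} {Y : Type u}
    [AddCommGroup Y] [Module A Y] [Module.Finite A Y] (hY : IsDeltaInjective e Y)
    (hj : ∀ S : Submodule A Y, IsSimpleModule A S → ∀ k < j, ∀ x ∈ S, e k • x = 0)
    {V : Type u} [AddCommGroup V] [Module A V] [IsSimpleModule A V]
    (hV : ∀ l, j ≤ l → ∀ x : V, e l • x = 0) : ExtVanishes A 1 V Y := by
  have := IsSimpleModule.nontrivial A V
  obtain ⟨v, hv⟩ := exists_ne (0 : V)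
  obtain ⟨k, hk⟩ := he.exists_smul_ne_zero hv
  have hkj : k < j := lt_of_not_ge fun h => hk (hV k h v)
  obtain ⟨q⟩ := nonempty_equiv_E he hk
  have hle : trace e k (P e k) ≤ LinearMap.ker (fromP e k v) := trace_le_iff.2 fun l hl x => by
    rw [LinearMap.mem_ker, map_smul]
    by_contra h
    exact hl.ne' (eq_of_smul_ne_zero he q h)
  rw [← sInf_eq_trace he] at hle
  let g : Delta e k →ₗ[A] V := Submodule.liftQ _ (fromP e k v) hle
  have hg : Function.Surjective g := by
    refine LinearMap.surjective_of_ne_zero fun h => hk ?_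
    have : g (toDelta e k (gen e k)) = 0 := by rw [h]; rfl
    exact this
  refine ExtVanishes.contravariant_right (LinearMap.ker g).injective_subtype
    (fun x => by simp) hg (ExtVanishes.zero_iff.2 fun φ => ?_) (hY k)
  by_contra hφ
  obtain ⟨S, hS, hSs⟩ := exists_simple_le (N := LinearMap.range φ)
    (fun h => hφ (LinearMap.range_eq_bot.1 h))
  have := IsSimpleModule.nontrivial A S
  obtain ⟨x, hx⟩ := exists_ne (0 : S)
  obtain ⟨l, hl⟩ := he.exists_smul_ne_zero hx
  refine hl (Subtype.ext ?_)
  change e l • (x : Y) = 0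
  rcases lt_or_ge k l with hkl | hlk
  · obtain ⟨d, hd⟩ := hS x.2
    rw [← hd, ← map_smul]
    have : e l • d = 0 := Subtype.ext (smul_Delta_eq_zero he hkl d.1)
    rw [this, map_zero]
  · exact hj S hSs l (hlk.trans_lt hkj) x x.2

theorem extVanishes_one_of_smul_eq_zero (he : IsBasicIdempotentSystem e) {j : Fin n} {Y : Type u}
    [AddCommGroup Y] [Module A Y] [Module.Finite A Y] (hY : IsDeltaInjective e Y)
    (hj : ∀ S : Submodule A Y, IsSimpleModule A S → ∀ k < j, ∀ x ∈ S, e k • x = 0)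
    {W : Type u} [AddCommGroup W] [Module A W] [Module.Finite A W]
    (hW : ∀ l, j ≤ l → ∀ x : W, e l • x = 0) : ExtVanishes A 1 W Y := by
  have hlen : IsFiniteLength A W :=
    isFiniteLength_iff_isNoetherian_isArtinian.2 ⟨inferInstance, inferInstance⟩
  induction hlen with
  | of_subsingleton => exact ExtVanishes.of_subsingleton_left 1
  | @of_simple_quotient M _ _ N _ _ ih =>
    refine ExtVanishes.contravariant_middle N.injective_subtype (g := N.mkQ) (fun x => by simp)
      N.mkQ_surjective (ih fun l hl x => Subtype.ext (hW l hl x))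
      (extVanishes_one_of_isSimpleModule he hY hj fun l hl x => ?_)
    obtain ⟨y, rfl⟩ := N.mkQ_surjective x
    rw [← map_smul, hW l hl, map_zero]

/-- Let `Y` be `Δ`-injective and nonzero, and let `j` be minimal such that `E(j)` embeds in `Y`.
Then the embedding extends to an embedding of the proper costandard module `∇̄(j)`. In particular,
`∇̄(j)` is finitely generated in this case: the lengths of its finitely generated submodules are
bounded by the length of `Y`. -/
theorem exists_isProperCostandard_embedding (he : IsBasicIdempotentSystem e) {Y : Type u}
    [AddCommGroup Y] [Module A Y] [Module.Finite A Y] [Nontrivial Y] (hY : IsDeltaInjective e Y) :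
    ∃ (B : ModuleCat.{u} A) (ψ : B →ₗ[A] Y), IsProperCostandard e B ∧ Module.Finite A B ∧
      Nontrivial B ∧ Function.Injective ψ := by
  obtain ⟨j, ⟨S, hSs, x₀, hx₀S, hx₀⟩, hmin⟩ := (wellFounded_lt (α := Fin n)).has_min
    {j | ∃ S : Submodule A Y, IsSimpleModule A S ∧ ∃ x ∈ S, e j • x ≠ 0} (by
      obtain ⟨S, -, hS⟩ := exists_simple_le (A := A) (N := (⊤ : Submodule A Y)) top_ne_bot
      have := IsSimpleModule.nontrivial A S
      obtain ⟨x, hx⟩ := exists_ne (0 : S)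
      obtain ⟨l, hl⟩ := he.exists_smul_ne_zero hx
      exact ⟨l, S, hS, x, x.2, fun h => hl (Subtype.ext h)⟩)
  have hj : ∀ S : Submodule A Y, IsSimpleModule A S → ∀ k < j, ∀ x ∈ S, e k • x = 0 := by
    intro S hS k hk x hx
    by_contra h
    exact hmin k ⟨S, hS, x, hx, h⟩ hk
  obtain ⟨q⟩ := nonempty_equiv_E he (i := j) (V := S) (x := ⟨x₀, hx₀S⟩)
    fun h => hx₀ (congrArg Subtype.val h)
  have hEs := isSimpleModule_E he j
  obtain ⟨Q, hQ⟩ := exists_isInjectiveEnvelope (A := A) (E e j)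
  obtain ⟨hQi, f, hf, hess⟩ := id hQ
  let r := (LinearEquiv.ofInjective f hf).symm
  have hmem := fun x => mem_nablaBar_iff he r hess (x := x)
  have hSk : ∀ k, j < k → ∀ y ∈ LinearMap.range f, e k • y = 0 := by
    rintro k hk _ ⟨y, rfl⟩
    rw [← map_smul, smul_E_eq_zero he hk.ne', map_zero]
  have hrB : LinearMap.range f ≤ nablaBar e j Q := fun x hx =>
    (hmem x).2 ⟨fun k hk a => hSk k hk _ (Submodule.smul_mem _ a hx),
      fun a => Submodule.smul_mem _ _ (Submodule.smul_mem _ a hx)⟩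
  have hemb : ∀ N : Submodule A Q, N.FG → LinearMap.range f ≤ N → N ≤ nablaBar e j Q →
      ∃ ψ : N →ₗ[A] Y, Function.Injective ψ := by
    intro N hN hfN hNB
    have : Module.Finite A N := Module.Finite.iff_fg.2 hN
    let R := (LinearMap.range f).submoduleOf N
    let r' : R ≃ₗ[A] E e j := (Submodule.submoduleOfEquivOfLe hfN).trans r
    have hext : ExtVanishes A 1 (N ⧸ R) Y := by
      refine extVanishes_one_of_smul_eq_zero he hY hj fun l hl x => ?_
      obtain ⟨y, rfl⟩ := R.mkQ_surjective x
      rw [← map_smul, Submodule.mkQ_apply, Submodule.Quotient.mk_eq_zero]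
      change e l • (y : Q) ∈ LinearMap.range f
      have hy := (hmem y).1 (hNB y.2)
      rcases hl.eq_or_lt with rfl | hl
      · simpa using hy.2 1
      · have := hy.1 l hl 1
        rw [one_smul] at this
        rw [this]
        exact Submodule.zero_mem _
    obtain ⟨ψ, hψ⟩ := hext.exists_extension R.injective_subtype (g := R.mkQ) (fun x => by simp)
      R.mkQ_surjective (S.subtype ∘ₗ (r'.trans q.symm).toLinearMap)
    refine ⟨ψ, LinearMap.ker_eq_bot.1 ?_⟩
    -- The kernel of the extension meets the essential socle trivially.
    have h0 : (LinearMap.ker ψ).map N.subtype = ⊥ := by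
      refine hess _ ?_
      rw [Submodule.eq_bot_iff]
      rintro _ ⟨⟨x, hx, rfl⟩, hxf⟩
      have h1 : ψ x = ((r'.trans q.symm) ⟨x, hxf⟩ : S) := LinearMap.congr_fun hψ ⟨x, hxf⟩
      rw [LinearMap.mem_ker.1 hx] at h1
      have h2 : (⟨x, hxf⟩ : R) = 0 :=
        (r'.trans q.symm).map_eq_zero_iff.1 (Subtype.ext h1.symm)
      have h3 : x = 0 := congrArg Subtype.val h2
      rw [h3, map_zero]
    rw [Submodule.eq_bot_iff]
    intro x hx
    have : (x : Q) ∈ (LinearMap.ker ψ).map N.subtype := ⟨x, hx, rfl⟩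
    rw [h0, Submodule.mem_bot] at this
    exact Subtype.ext this
  have hlenY : Module.length A Y ≠ ⊤ := Module.length_ne_top
  have hfg : (nablaBar e j Q).FG := by
    let T : Set ℕ := {m | ∃ N : Submodule A Q, N.FG ∧ LinearMap.range f ≤ N ∧
      N ≤ nablaBar e j Q ∧ Module.length A N = m}
    have hle : ∀ N : Submodule A Q, N.FG → LinearMap.range f ≤ N → N ≤ nablaBar e j Q →
        Module.length A N ≤ Module.length A Y := fun N h1 h2 h3 => by
      obtain ⟨ψ, hψ⟩ := hemb N h1 h2 h3
      exact Module.length_le_of_injective ψ hψ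
    have hfgr : (LinearMap.range f).FG := by
      have : Module.Finite A (E e j) := inferInstance
      exact Module.Finite.iff_fg.1 inferInstance
    have hTne : T.Nonempty := by
      obtain ⟨m, hm⟩ := ENat.ne_top_iff_exists.1
        (ne_top_of_le_ne_top hlenY (hle _ hfgr le_rfl hrB))
      exact ⟨m, _, hfgr, le_rfl, hrB, hm.symm⟩
    have hTb : BddAbove T := by
      obtain ⟨m, hm⟩ := ENat.ne_top_iff_exists.1 hlenY
      refine ⟨m, ?_⟩
      rintro m' ⟨N, h1, h2, h3, h4⟩
      have := hle N h1 h2 h3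
      rw [h4, ← hm] at this
      exact_mod_cast this
    obtain ⟨N, h1, h2, h3, h4⟩ := Nat.sSup_mem hTne hTb
    suffices h : nablaBar e j Q ≤ N by
      rwa [le_antisymm h h3]
    intro x hx
    have hxN : N ⊔ Submodule.span A {x} ≤ nablaBar e j Q :=
      sup_le h3 ((Submodule.span_singleton_le_iff_mem _ _).2 hx)
    have hfgN : (N ⊔ Submodule.span A {x}).FG := h1.sup (Submodule.fg_span_singleton x)
    have hNl := hle _ hfgN (h2.trans le_sup_left) hxN
    obtain ⟨m, hm⟩ := ENat.ne_top_iff_exists.1 (ne_top_of_le_ne_top hlenY hNl)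
    have hmle : m ≤ sSup T := le_csSup hTb ⟨_, hfgN, h2.trans le_sup_left, hxN, hm.symm⟩
    by_contra hxn
    have hlt : N < N ⊔ Submodule.span A {x} := by
      refine lt_of_le_of_ne le_sup_left fun h => hxn ?_
      rw [h]
      exact Submodule.mem_sup_right (Submodule.mem_span_singleton_self x)
    have : Module.Finite A ↥(N ⊔ Submodule.span A {x}) := Module.Finite.iff_fg.2 hfgN
    let N' := N.submoduleOf (N ⊔ Submodule.span A {x})
    have hN' : N' ≠ ⊤ := fun h => hlt.not_ge (Submodule.submoduleOf_eq_top.1 h)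
    have hl := Submodule.length_lt hN'
    rw [(Submodule.submoduleOfEquivOfLe hlt.le).length_eq, h4, ← hm] at hl
    exact absurd (ENat.natCast_lt_natCast.1 hl) (not_lt.2 hmle)
  obtain ⟨ψ, hψ⟩ := hemb _ hfg hrB le_rfl
  refine ⟨ModuleCat.of A (nablaBar e j Q), ψ, ⟨j, Q, hQ, ⟨LinearEquiv.refl A _⟩⟩,
    Module.Finite.iff_fg.2 hfg, ?_, hψ⟩
  have := IsSimpleModule.nontrivial A (E e j)
  have hinj : Function.Injective (LinearMap.codRestrict (nablaBar e j Q) f fun x => hrB ⟨x, rfl⟩) :=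
    fun a b h => hf (congrArg Subtype.val h)
  exact hinj.nontrivial

/-- The finitely generated `Δ`-injective modules are the modules in `F(∇̄)`. -/
theorem hasFiltration_isProperCostandard_iff (he : IsBasicIdempotentSystem e)
    (hA : IsStandardlyStratified e) {Y : Type u} [AddCommGroup Y] [Module A Y] [Module.Finite A Y] :
    HasFiltration (IsProperCostandard e) (ModuleCat.of A Y) ↔ IsDeltaInjective e Y := by
  refine ⟨HasFiltration.isDeltaInjective he, fun hY => ?_⟩
  have key : ∀ (l : ℕ) (Y : Type u) [AddCommGroup Y] [Module A Y] [Module.Finite A Y],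
      Module.length A Y < l → IsDeltaInjective e Y →
      HasFiltration (IsProperCostandard e) (ModuleCat.of A Y) := by
    intro l
    induction l with
    | zero => intro Y _ _ _ h; simp at h
    | succ l ih =>
      intro Y _ _ _ hl hY
      rcases subsingleton_or_nontrivial Y with hs | hs
      · exact HasFiltration.of_subsingleton Y
      obtain ⟨B, ψ, hB, hBf, hBn, hψ⟩ := exists_isProperCostandard_embedding he hY
      have hBgood : IsDeltaInjective e B :=
        fun i => extVanishes_one_of_isProperCostandard he hB i
      have hexact : Function.Exact ψ (LinearMap.range ψ).mkQ := fun x => by simp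
      have hsurj := (LinearMap.range ψ).mkQ_surjective
      have hlen := Module.length_eq_add_of_exact ψ (LinearMap.range ψ).mkQ hψ hsurj hexact
      have hpos : 0 < Module.length A B := Module.length_pos
      refine HasFiltration.extension hψ hexact hsurj (HasFiltration.of_mem hBf hB)
        (ih (Y ⧸ LinearMap.range ψ) ?_ fun i => ExtVanishes.covariant_right hψ hexact hsurj (hY i)
          (hBgood.extVanishes he hA 1 i))
      obtain ⟨m, hm⟩ := ENat.ne_top_iff_exists.1 (Module.length_ne_top (R := A)
        (M := Y ⧸ LinearMap.range ψ))
      obtain ⟨m', hm'⟩ := ENat.ne_top_iff_exists.1 (Module.length_ne_top (R := A) (M := B))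
      rw [hlen, ← hm, ← hm'] at hl
      rw [← hm'] at hpos
      rw [← hm]
      norm_cast at hl hpos ⊢
      omega
  obtain ⟨m, hm⟩ := ENat.ne_top_iff_exists.1 (Module.length_ne_top (R := A) (M := Y))
  refine key (m + 1) Y ?_ hY
  rw [← hm]
  exact_mod_cast Nat.lt_succ_self m

end Good

/-! ### Approximation by universal extensions -/

section Approximation

variable {R : Type v} [CommRing R] {A : Type u} [Ring A] [Algebra R A] {n : ℕ} {e : Fin n → A}

/-- Multiplication by a central scalar. -/
def centralSMul (A : Type u) [Ring A] [Algebra R A] (M : Type*) [AddCommGroup M] [Module A M]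
    (c : R) : M →ₗ[A] M where
  toFun x := algebraMap R A c • x
  map_add' := smul_add _
  map_smul' a x := by
    rw [RingHom.id_apply, ← mul_smul, ← mul_smul, Algebra.commutes]

theorem centralSMul_apply (A : Type u) [Ring A] [Algebra R A] {M : Type*} [AddCommGroup M]
    [Module A M] (c : R) (x : M) : centralSMul A M c x = algebraMap R A c • x := rfl

/-- `Hom_A(K, X)` is finitely generated over `R` if `K` and `X` are finitely generated. -/
theorem exists_hom_generators (R : Type v) [CommRing R] [IsArtinianRing R] [Algebra R A]
    [Module.Finite R A] (K X : Type u) [AddCommGroup K] [Module A K]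
    [AddCommGroup X] [Module A X] [Module.Finite A K] [Module.Finite A X] :
    ∃ (m : ℕ) (h : Fin m → (K →ₗ[A] X)), ∀ φ : K →ₗ[A] X, ∃ c : Fin m → R,
      ∀ x, φ x = ∑ l, algebraMap R A (c l) • h l x := by
  let : Module R X := Module.compHom X (algebraMap R A)
  have : IsScalarTower R A X := ⟨fun r a x => by
    rw [Algebra.smul_def, mul_smul]; rfl⟩
  have : Module.Finite R X := Module.Finite.trans A X
  obtain ⟨p, s, hs⟩ := Module.Finite.exists_fin (R := A) (M := K)
  let ev : (K →ₗ[A] X) →ₗ[R] (Fin p → X) :=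
    { toFun := fun φ l => φ (s l)
      map_add' := fun _ _ => rfl
      map_smul' := fun _ _ => rfl }
  have hev : Function.Injective ev := fun φ ψ h =>
    LinearMap.ext_on_range hs fun l => congrFun h l
  have : Module.Finite R (K →ₗ[A] X) := Module.Finite.of_injective ev hev
  obtain ⟨m, h, hh⟩ := Module.Finite.exists_fin (R := R) (M := K →ₗ[A] X)
  refine ⟨m, h, fun φ => ?_⟩
  obtain ⟨c, hc⟩ := (Submodule.mem_span_range_iff_exists_fun R).1
    (hh ▸ Submodule.mem_top : φ ∈ Submodule.span R (Set.range h))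
  refine ⟨c, fun x => ?_⟩
  rw [← hc, LinearMap.sum_apply]
  rfl

/-- The universal extension of `X` by copies of `Δ(i)`. It is the pushout of `K^m → X` along
`K^m → P(i)^m`, where `K` is the kernel of `P(i) → Δ(i)` and the components of `K^m → X` generate
`Hom(K, X)`. -/
theorem exists_universal_extension (R : Type v) [CommRing R] [IsArtinianRing R] [Algebra R A]
    [Module.Finite R A] (he : IsBasicIdempotentSystem e) (i : Fin n) (X : Type u)
    [AddCommGroup X] [Module A X] [Module.Finite A X] :
    ∃ (X' : ModuleCat.{u} A) (m : ℕ) (f : X →ₗ[A] X') (g : X' →ₗ[A] (Fin m → Delta e i)),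
      Function.Injective f ∧ Function.Exact f g ∧ Function.Surjective g ∧
      ExtVanishes A 1 (Delta e i) X' := by
  have : IsArtinianRing A := IsArtinianRing.of_finite R A
  let K := trace e i (P e i)
  obtain ⟨m, h, hh⟩ := exists_hom_generators (A := A) R K X
  let u : (Fin m → K) →ₗ[A] X × (Fin m → P e i) :=
    LinearMap.prod (-∑ l, h l ∘ₗ LinearMap.proj l)
      (LinearMap.pi fun l => K.subtype ∘ₗ LinearMap.proj l)
  have hu1 : ∀ c, (u c).1 = -∑ l, h l (c l) := fun c => by simp [u]
  have hu2 : ∀ c l, (u c).2 l = c l := fun c l => rfl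
  let U := LinearMap.range u
  let f : X →ₗ[A] (X × (Fin m → P e i)) ⧸ U := U.mkQ ∘ₗ LinearMap.inl A X (Fin m → P e i)
  have hf : Function.Injective f := by
    rw [← LinearMap.ker_eq_bot, Submodule.eq_bot_iff]
    intro x hx
    obtain ⟨c, hc⟩ := (Submodule.Quotient.mk_eq_zero U).1 (LinearMap.mem_ker.1 hx)
    have hc0 : c = 0 := by
      ext l : 2
      rw [← hu2, hc]
      rfl
    rw [hc0, map_zero] at hc
    exact (congrArg Prod.fst hc).symm
  let g₀ : X × (Fin m → P e i) →ₗ[A] (Fin m → Delta e i) :=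
    LinearMap.pi fun l => toDelta e i ∘ₗ LinearMap.proj l ∘ₗ LinearMap.snd A X (Fin m → P e i)
  have hg₀ : U ≤ LinearMap.ker g₀ := by
    rintro _ ⟨c, rfl⟩
    refine funext fun l => ?_
    exact (toDelta_eq_zero_iff he i _).2 (c l).2
  let g : (X × (Fin m → P e i)) ⧸ U →ₗ[A] (Fin m → Delta e i) := U.liftQ g₀ hg₀
  have hfg : Function.Exact f g := by
    intro y
    obtain ⟨⟨x, p⟩, rfl⟩ := U.mkQ_surjective y
    constructor
    · intro hy
      have hp : ∀ l, p l ∈ K := fun l => (toDelta_eq_zero_iff he i _).1 (congrFun hy l)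
      refine ⟨x + ∑ l, h l ⟨p l, hp l⟩, ?_⟩
      refine ((Submodule.Quotient.eq U).2 ⟨fun l => -⟨p l, hp l⟩, Prod.ext ?_ ?_⟩)
      · rw [hu1]
        simp
      · ext l : 2
        simp [hu2]
    · rintro ⟨x', hx'⟩
      rw [← hx']
      refine funext fun l => ?_
      exact map_zero (toDelta e i)
  have hg : Function.Surjective g := by
    intro d
    exact ⟨U.mkQ (0, fun l => (toDelta_surjective i (d l)).choose),
      funext fun l => (toDelta_surjective i (d l)).choose_spec⟩
  refine ⟨ModuleCat.of A ((X × (Fin m → P e i)) ⧸ U), m, f, g, hf, hfg, hg, ?_⟩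
  refine extVanishes_one_Delta he fun φ => ?_
  -- A map from `K` to the extension lands in `X`, because there are no maps from `K` to `Δ(i)`.
  have hgφ : g ∘ₗ φ = 0 := hom_trace_eq_zero (Y := Fin m → Delta e i) he
    (fun j hj y => funext fun l => smul_Delta_eq_zero he hj (y l)) _
  have hφ : ∀ x, φ x ∈ LinearMap.range f := fun x =>
    (hfg _).1 (LinearMap.congr_fun hgφ x)
  let φ' : K →ₗ[A] X :=
    (LinearEquiv.ofInjective f hf).symm.toLinearMap ∘ₗ LinearMap.codRestrict _ φ hφ
  have hφ' : ∀ x, f (φ' x) = φ x := fun x =>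
    congrArg Subtype.val ((LinearEquiv.ofInjective f hf).apply_symm_apply ⟨φ x, hφ x⟩)
  obtain ⟨c, hc⟩ := hh φ'
  refine ⟨U.mkQ ∘ₗ LinearMap.inr A X (Fin m → P e i) ∘ₗ
    LinearMap.pi fun l => centralSMul A (P e i) (c l), ?_⟩
  ext x : 1
  rw [← hφ']
  refine (Submodule.Quotient.eq U).2 ⟨fun l => algebraMap R A (c l) • x, Prod.ext ?_ ?_⟩
  · rw [hu1]
    change _ = 0 - φ' x
    rw [hc, zero_sub]
    exact congrArg Neg.neg (Finset.sum_congr rfl fun l _ => map_smul _ _ _)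
  · ext l : 2
    simp [hu2, centralSMul_apply]

/-- Every finitely generated module `X` embeds in a finitely generated `Δ`-injective module with
cokernel in `F(Δ)`. Universal extensions by `Δ(n), …, Δ(1)`, in this order, do not destroy what the
earlier ones have achieved, since `Ext¹(Δ(i), Δ(t)) = 0` for `t ≤ i`. -/
theorem exists_isDeltaInjective_embedding (R : Type v) [CommRing R] [IsArtinianRing R] [Algebra R A]
    [Module.Finite R A] (he : IsBasicIdempotentSystem e) (X : Type u)
    [AddCommGroup X] [Module A X] [Module.Finite A X] :
    ∃ (Y Z : ModuleCat.{u} A) (f : X →ₗ[A] Y) (g : Y →ₗ[A] Z),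
      Function.Injective f ∧ Function.Exact f g ∧ Function.Surjective g ∧ Module.Finite A Y ∧
      (∀ i, ExtVanishes A 1 (Delta e i) Y) ∧ HasFiltration (IsStandard e) Z := by
  have : IsArtinianRing A := IsArtinianRing.of_finite R A
  have key : ∀ t ≤ n, ∃ (Y : ModuleCat.{u} A) (f : X →ₗ[A] Y), Function.Injective f ∧
      Module.Finite A Y ∧ (∀ i : Fin n, t ≤ i → ExtVanishes A 1 (Delta e i) Y) ∧
      HasFiltration (IsStandard e) (ModuleCat.of A (Y ⧸ LinearMap.range f)) := by
    intro t ht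
    induction ht using Nat.decreasingInduction with
    | self =>
      refine ⟨ModuleCat.of A X, LinearMap.id, Function.injective_id, ‹_›,
        fun i hi => absurd i.2 (not_lt.2 hi), ?_⟩
      have : Subsingleton (X ⧸ LinearMap.range (LinearMap.id : X →ₗ[A] X)) := by
        rw [Submodule.Quotient.subsingleton_iff, LinearMap.range_id]
      exact HasFiltration.of_subsingleton _
    | of_succ t ht ih =>
      obtain ⟨Y, f, hf, hYfin, hY, hZ⟩ := ih
      obtain ⟨Y', m, ι, π, hι, hιπ, hπ, hY'⟩ := exists_universal_extension R he ⟨t, ht⟩ Y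
      refine ⟨Y', ι ∘ₗ f, hι.comp hf,
        finite_of_exact hιπ hπ hYfin inferInstance, fun i hi => ?_, ?_⟩
      · rcases Nat.eq_or_lt_of_le hi with h | h
        · obtain rfl : i = ⟨t, ht⟩ := Fin.ext h.symm
          exact hY'
        · refine ExtVanishes.covariant_middle hι hιπ hπ (hY i h) (ExtVanishes.pi_right ?_ m)
          exact extVanishes_one_Delta_of_smul he fun j hj y =>
            smul_Delta_eq_zero he (lt_trans (Fin.lt_def.2 h) hj) y
      · let α : (Y ⧸ LinearMap.range f) →ₗ[A] (Y' ⧸ LinearMap.range (ι ∘ₗ f)) :=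
          (LinearMap.range f).mapQ _ ι (by rintro _ ⟨x, rfl⟩; exact ⟨x, rfl⟩)
        let β : (Y' ⧸ LinearMap.range (ι ∘ₗ f)) →ₗ[A] (Fin m → Delta e ⟨t, ht⟩) :=
          (LinearMap.range (ι ∘ₗ f)).liftQ π (by
            rintro _ ⟨x, rfl⟩
            exact hιπ.apply_apply_eq_zero (f x))
        refine HasFiltration.extension (f := α) (g := β) ?_ ?_ ?_ hZ
          (HasFiltration.pi (HasFiltration.of_mem inferInstance
            ⟨⟨t, ht⟩, ⟨LinearEquiv.refl A _⟩⟩) m)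
        · rw [← LinearMap.ker_eq_bot, Submodule.eq_bot_iff]
          intro y hy
          obtain ⟨y, rfl⟩ := (LinearMap.range f).mkQ_surjective y
          obtain ⟨x, hx⟩ := (Submodule.Quotient.mk_eq_zero (LinearMap.range (ι ∘ₗ f))).1
            (LinearMap.mem_ker.1 hy)
          exact (Submodule.Quotient.mk_eq_zero _).2 ⟨x, hι hx⟩
        · intro y
          obtain ⟨y, rfl⟩ := (LinearMap.range (ι ∘ₗ f)).mkQ_surjective y
          refine (hιπ y).trans ⟨?_, ?_⟩
          · rintro ⟨z, rfl⟩
            exact ⟨(LinearMap.range f).mkQ z, rfl⟩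
          · rintro ⟨z, hz⟩
            obtain ⟨z, rfl⟩ := (LinearMap.range f).mkQ_surjective z
            obtain ⟨x, hx⟩ := (Submodule.Quotient.eq (LinearMap.range (ι ∘ₗ f))).1 hz
            refine ⟨z - f x, ?_⟩
            have hx' : ι (f x) = ι z - y := hx
            rw [map_sub, hx', sub_sub_cancel]
        · intro d
          obtain ⟨y, rfl⟩ := hπ d
          exact ⟨(LinearMap.range (ι ∘ₗ f)).mkQ y, rfl⟩
  obtain ⟨Y, f, hf, hYfin, hY, hZ⟩ := key 0 (Nat.zero_le n)
  exact ⟨Y, ModuleCat.of A (Y ⧸ LinearMap.range f), f, (LinearMap.range f).mkQ, hf,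
    fun x => by simp, Submodule.mkQ_surjective _, hYfin, fun i => hY i (Nat.zero_le _), hZ⟩

end Approximation

/-! ### Good filtration dimension, codimension and projective dimension -/

section Dimensions

variable {A : Type u} [Ring A] {n : ℕ} {e : Fin n → A}

theorem gfd_le_codim {T : ModuleCat.{u} A} (hT : IsCharacteristicModule e T)
    {X : ModuleCat.{u} A} {m : ℕ} (h : codim T X ≤ m) : gfd e X ≤ m := by
  obtain ⟨d, hd, hX⟩ := coresolutionDim_le_iff.1 h
  exact coresolutionDim_le_iff.2 ⟨d, hd, hX.mono fun M hM => ((hT M).1 hM).2⟩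

theorem IsCharacteristicModule.hasFiltration {T : ModuleCat.{u} A}
    (hT : IsCharacteristicModule e T) : HasFiltration (IsStandard e) T :=
  ((hT T).1 ⟨1, LinearMap.pi fun _ => LinearMap.id, LinearMap.proj 0, rfl⟩).1

theorem IsInAdd.extVanishes {T M : ModuleCat.{u} A} (hM : IsInAdd T M) {k : ℕ} {N : Type u}
    [AddCommGroup N] [Module A N] (h : ExtVanishes A k T N) : ExtVanishes A k M N := by
  obtain ⟨p, ι, π, hιπ⟩ := hM
  exact (h.pi_left p).retract_left ι π hιπ

variable [IsArtinianRing A]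

/-- Coresolutions built from embeddings in `Δ`-injective modules, for the modules in a class `D`
that contains the cokernels of the embeddings. -/
theorem exists_hasCoresolution (he : IsBasicIdempotentSystem e) (hA : IsStandardlyStratified e)
    {C D : ModuleCat.{u} A → Prop}
    (hD : ∀ X, D X → ∃ (Y Z : ModuleCat.{u} A) (f : X →ₗ[A] Y) (g : Y →ₗ[A] Z),
      Function.Injective f ∧ Function.Exact f g ∧ Function.Surjective g ∧
      IsDeltaInjective e Y ∧ C Y ∧ D Z)
    (hC : ∀ X : ModuleCat.{u} A, D X → IsDeltaInjective e X → C X) (m : ℕ) :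
    ∀ X, D X → (∀ i, ExtVanishes A (m + 1) (Delta e i) X) → HasCoresolution C X m := by
  induction m with
  | zero => exact fun X hX h => HasCoresolution.zero (hC X hX h)
  | succ m ih =>
    intro X hX h
    obtain ⟨Y, Z, f, g, hf, hfg, hg, hY, hCY, hDZ⟩ := hD X hX
    exact HasCoresolution.succ hf hfg hg hCY (ih Z hDZ fun i =>
      ExtVanishes.covariant_right hf hfg hg (hY.extVanishes he hA m i) (h i))

theorem extVanishes_of_gfd_le (he : IsBasicIdempotentSystem e) (hA : IsStandardlyStratified e)
    {X : ModuleCat.{u} A} {m : ℕ} (h : gfd e X ≤ m) (k : ℕ) (i : Fin n) :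
    ExtVanishes A (m + k + 1) (Delta e i) X := by
  obtain ⟨d, hd, hX⟩ := coresolutionDim_le_iff.1 h
  have := hX.extVanishes (Y := Delta e i)
    (fun M hM l => (HasFiltration.isDeltaInjective he hM).extVanishes he hA l i) (m - d + k)
  rwa [show d + (m - d + k) + 1 = m + k + 1 by omega] at this

/-- If `Ext^k(Δ, A) = 0` for `k > m`, then `proj.dim T ≤ m`: the functors `Ext^k(T, -)` vanish for
large `k`, and the last one that is nonzero is right exact, hence nonzero on `A`. -/
theorem hasProjectiveDimensionLE_of_extVanishes_regular (he : IsBasicIdempotentSystem e)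
    (hA : IsStandardlyStratified e) {T : ModuleCat.{u} A} (hT : HasFiltration (IsStandard e) T)
    {m : ℕ} (h : ∀ k i, ExtVanishes A (m + k + 1) (Delta e i) A) :
    HasProjectiveDimensionLE T m := by
  have key : ∀ t k, n ≤ m + k + 1 + t → ∀ (N : Type u) [AddCommGroup N] [Module A N]
      [Module.Finite A N], ExtVanishes A (m + k + 1) T N := by
    intro t
    induction t with
    | zero =>
      intro k hk N _ _ _
      exact HasFiltration.extVanishes_of_Delta hT
        fun i => extVanishes_Delta_of_le he hA _ i (by omega)
    | succ t ih =>
      intro k hk N _ _ _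
      obtain ⟨p, π, hπ⟩ := Module.Finite.exists_fin' A N
      exact ExtVanishes.covariant_right (LinearMap.ker π).injective_subtype
        (fun x => by simp) hπ
        (ExtVanishes.pi_right (HasFiltration.extVanishes_of_Delta hT (h k)) p)
        (ih (k + 1) (by omega) (LinearMap.ker π))
  have : Module.Finite A T := hT.1
  exact hasProjectiveDimensionLE_of_extVanishes m T fun N _ _ _ => key n 0 (by omega) N

end Dimensions

section Characteristic

variable {R : Type v} [CommRing R] [IsArtinianRing R] {A : Type u} [Ring A] [Algebra R A]
  [Module.Finite R A] {n : ℕ} {e : Fin n → A}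

theorem gfd_le_iff (R : Type v) [CommRing R] [IsArtinianRing R] [Algebra R A] [Module.Finite R A]
    (he : IsBasicIdempotentSystem e) (hA : IsStandardlyStratified e)
    {X : ModuleCat.{u} A} (hX : Module.Finite A X) {m : ℕ} :
    gfd e X ≤ m ↔ ∀ i, ExtVanishes A (m + 1) (Delta e i) X := by
  have : IsArtinianRing A := IsArtinianRing.of_finite R A
  refine ⟨fun h i => extVanishes_of_gfd_le he hA h 0 i, fun h => ?_⟩
  refine coresolutionDim_le_iff.2 ⟨m, le_rfl, exists_hasCoresolution he hA
    (D := fun X => Module.Finite A X) ?_ ?_ m X hX h⟩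
  · intro X hX
    obtain ⟨Y, Z, f, g, hf, hfg, hg, hYfin, hY, hZ⟩ := exists_isDeltaInjective_embedding R he X
    exact ⟨Y, Z, f, g, hf, hfg, hg, hY, (hasFiltration_isProperCostandard_iff he hA).2 hY, hZ.1⟩
  · exact fun X hX hXinj => (hasFiltration_isProperCostandard_iff he hA).2 hXinj

/-- For `X` in `F(Δ)` the embedding in a `Δ`-injective module is an embedding in a module in
`add T`, with cokernel in `F(Δ)`. -/
theorem exists_isInAdd_embedding (R : Type v) [CommRing R] [IsArtinianRing R] [Algebra R A]
    [Module.Finite R A] (he : IsBasicIdempotentSystem e) (hA : IsStandardlyStratified e)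
    {T : ModuleCat.{u} A} (hT : IsCharacteristicModule e T)
    {X : ModuleCat.{u} A} (hX : HasFiltration (IsStandard e) X) :
    ∃ (Y Z : ModuleCat.{u} A) (f : X →ₗ[A] Y) (g : Y →ₗ[A] Z),
      Function.Injective f ∧ Function.Exact f g ∧ Function.Surjective g ∧
      IsDeltaInjective e Y ∧ IsInAdd T Y ∧ HasFiltration (IsStandard e) Z := by
  have : IsArtinianRing A := IsArtinianRing.of_finite R A
  have := hX.1
  obtain ⟨Y, Z, f, g, hf, hfg, hg, hYfin, hY, hZ⟩ := exists_isDeltaInjective_embedding R he X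
  exact ⟨Y, Z, f, g, hf, hfg, hg, hY, (hT Y).2 ⟨HasFiltration.extension hf hfg hg hX hZ,
    (hasFiltration_isProperCostandard_iff he hA).2 hY⟩, hZ⟩

theorem codim_le_of_extVanishes (R : Type v) [CommRing R] [IsArtinianRing R] [Algebra R A]
    [Module.Finite R A] (he : IsBasicIdempotentSystem e) (hA : IsStandardlyStratified e)
    {T : ModuleCat.{u} A} (hT : IsCharacteristicModule e T)
    {X : ModuleCat.{u} A} (hX : HasFiltration (IsStandard e) X) {m : ℕ}
    (h : ∀ i, ExtVanishes A (m + 1) (Delta e i) X) : codim T X ≤ m := by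
  have : IsArtinianRing A := IsArtinianRing.of_finite R A
  refine coresolutionDim_le_iff.2 ⟨m, le_rfl, exists_hasCoresolution he hA
    (D := fun X => HasFiltration (IsStandard e) X)
    (fun X hX => exists_isInAdd_embedding R he hA hT hX)
    (fun X hX hXinj => (hT X).2 ⟨hX, ?_⟩) m X hX h⟩
  have := hX.1
  exact (hasFiltration_isProperCostandard_iff he hA).2 hXinj

/-- The modules in `F(Δ)` have projective dimension at most that of `T`: in
`0 → X → Y → Z → 0` with `Y` in `add T` and `Z` in `F(Δ)`, a nonzero `Ext^k(X, N)`,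
`k > proj.dim T`, gives a nonzero `Ext^(k+1)(Z, N)`, but the projective dimensions of the modules
in `F(Δ)` are bounded. -/
theorem extVanishes_of_hasProjectiveDimensionLE (R : Type v) [CommRing R] [IsArtinianRing R]
    [Algebra R A] [Module.Finite R A] (he : IsBasicIdempotentSystem e)
    (hA : IsStandardlyStratified e) {T : ModuleCat.{u} A} (hT : IsCharacteristicModule e T) {m : ℕ}
    (h : HasProjectiveDimensionLE T m) {X : ModuleCat.{u} A}
    (hX : HasFiltration (IsStandard e) X) (N : Type u) [AddCommGroup N] [Module A N] :
    ExtVanishes A (m + 1) X N := by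
  have : IsArtinianRing A := IsArtinianRing.of_finite R A
  have key : ∀ t k, n ≤ m + k + 1 + t → ∀ X : ModuleCat.{u} A, HasFiltration (IsStandard e) X →
      ExtVanishes A (m + k + 1) X N := by
    intro t
    induction t with
    | zero =>
      intro k hk X hX
      exact HasFiltration.extVanishes_of_Delta hX
        fun i => extVanishes_Delta_of_le he hA _ i (by omega)
    | succ t ih =>
      intro k hk X hX
      obtain ⟨Y, Z, f, g, hf, hfg, hg, -, hY, hZ⟩ := exists_isInAdd_embedding R he hA hT hX
      refine ExtVanishes.contravariant_left hf hfg hg (hY.extVanishes ?_)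
        (ih (k + 1) (by omega) Z hZ)
      exact HasProjectiveDimensionLT.subsingleton T (m + 1) (m + k + 1) (by omega)
        (ModuleCat.of A N)
  exact key n 0 (by omega) X hX

theorem nontrivial_of_isCharacteristicModule (R : Type v) [CommRing R] [IsArtinianRing R]
    [Algebra R A] [Module.Finite R A] [Nontrivial A] (he : IsBasicIdempotentSystem e)
    (hA : IsStandardlyStratified e) {T : ModuleCat.{u} A} (hT : IsCharacteristicModule e T) :
    Nontrivial T := by
  by_contra hcon
  rw [not_nontrivial_iff_subsingleton] at hcon
  obtain ⟨Y, Z, f, g, hf, -, -, -, ⟨p, ι, π, hιπ⟩, -⟩ := exists_isInAdd_embedding R he hA hT hA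
  have h : ∀ y : Y, y = 0 := fun y => by
    have := LinearMap.congr_fun hιπ y
    rw [← LinearMap.id_apply (R := A) y, ← this, LinearMap.comp_apply,
      Subsingleton.elim (ι y) 0, map_zero]
  exact one_ne_zero (hf ((h (f (1 : A))).trans (h (f (0 : A))).symm))

end Characteristic

theorem eq_of_forall_le_natCast_iff {x y : ℕ∞} (h : ∀ m : ℕ, x ≤ m ↔ y ≤ m) : x = y := by
  have key : ∀ {x y : ℕ∞}, (∀ m : ℕ, x ≤ m ↔ y ≤ m) → x ≤ y := by
    intro x y h
    cases y with
    | top => exact le_top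
    | coe m => exact (h m).2 le_rfl
  exact le_antisymm (key h) (key fun m => (h m).symm)

end StdStrat

theorem theorem2p5 {R : Type v} [CommRing R] [IsArtinianRing R]
    {A : Type u} [Ring A] [Nontrivial A] [Algebra R A] [Module.Finite R A]
    {n : ℕ} (e : Fin n → A) (he : StdStrat.IsBasicIdempotentSystem e)
    (hA : StdStrat.IsStandardlyStratified e)
    (T : ModuleCat.{u} A) (hT : StdStrat.IsCharacteristicModule e T) (d : ℕ) :
    List.TFAE
      [StdStrat.gfdAlgebra e = (d : ℕ∞),
       CategoryTheory.projectiveDimension T = ((d : ℕ∞) : WithBot ℕ∞),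
       StdStrat.gfd e (ModuleCat.of A A) = (d : ℕ∞),
       StdStrat.codim T (ModuleCat.of A A) = (d : ℕ∞)] := by
  open StdStrat in
  have : IsArtinianRing A := IsArtinianRing.of_finite R A
  have hfin : Module.Finite A (ModuleCat.of A A) := inferInstanceAs (Module.Finite A A)
  have hnt := nontrivial_of_isCharacteristicModule R he hA hT
  obtain ⟨p, hp⟩ := WithBot.ne_bot_iff_exists.1 (show projectiveDimension T ≠ ⊥ by
    rw [Ne, projectiveDimension_eq_bot_iff, ModuleCat.isZero_iff_subsingleton]
    exact not_subsingleton T)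
  have hpd : ∀ m : ℕ, p ≤ m ↔ HasProjectiveDimensionLE T m := fun m => by
    rw [← projectiveDimension_le_iff, ← hp]
    exact WithBot.coe_le_coe.symm
  have h13 : ∀ m : ℕ, gfdAlgebra e ≤ m → gfd e (ModuleCat.of A A) ≤ m := fun m h =>
    (le_iSup₂ (f := fun (X : ModuleCat.{u} A) (_ : Module.Finite A X) => gfd e X)
      (ModuleCat.of A A) hfin).trans h
  have h32 : ∀ m : ℕ, gfd e (ModuleCat.of A A) ≤ m → p ≤ m := fun m h =>
    (hpd m).2 (hasProjectiveDimensionLE_of_extVanishes_regular he hA hT.hasFiltration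
      (extVanishes_of_gfd_le he hA h))
  have h21 : ∀ m : ℕ, p ≤ m → gfdAlgebra e ≤ m := fun m h =>
    iSup₂_le fun X hX => (gfd_le_iff R he hA hX).2 fun i =>
      extVanishes_of_hasProjectiveDimensionLE R he hA hT ((hpd m).1 h) (X := ModuleCat.of A _)
        (HasFiltration.of_mem (finite_Delta i) ⟨i, ⟨LinearEquiv.refl A _⟩⟩) X
  have h34 : ∀ m : ℕ, gfd e (ModuleCat.of A A) ≤ m → codim T (ModuleCat.of A A) ≤ m := fun m h =>
    codim_le_of_extVanishes R he hA hT hA ((gfd_le_iff R he hA hfin).1 h)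
  have e12 : gfdAlgebra e = p := eq_of_forall_le_natCast_iff fun m =>
    ⟨fun h => h32 m (h13 m h), h21 m⟩
  have e32 : gfd e (ModuleCat.of A A) = p := eq_of_forall_le_natCast_iff fun m =>
    ⟨h32 m, fun h => h13 m (h21 m h)⟩
  have e42 : codim T (ModuleCat.of A A) = p := eq_of_forall_le_natCast_iff fun m =>
    ⟨fun h => h32 m (gfd_le_codim hT h), fun h => h34 m (h13 m (h21 m h))⟩
  rw [e12, e32, e42, ← hp, WithBot.coe_inj]
  tfae_have 1 ↔ 2 := Iff.rfl
  tfae_have 2 ↔ 3 := Iff.rfl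
  tfae_have 3 ↔ 4 := Iff.rfl
  tfae_finish
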